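/- **Theorem 1 (Convergence of KS-mADMM).** Let $T\ge 1$, $\mu>0$, $\gamma>0$. Consider the dynamic generalised group Lasso problem for an affine Gaussian state-space model, $$\min_{x_{1:T}}\ f(x)+\sum_{t=1}^T\sum_{g=1}^{N_g}\mu\,\|G_{g,t}\,u_t(x)\|_2,\qquad u_1(x)=x_1-d_1,\quad u_t(x)=x_t-B_tx_{t-1}-d_t\ (t\ge2),$$ $$f(x)=\tfrac12\sum_{t=1}^T\|y_t-H_tx_t-e_t\|^2_{R_t^{-1}}+\tfrac12\sum_{t=2}^T\|x_t-A_tx_{t-1}-b_t\|^2_{Q_t^{-1}}+\tfrac12\|x_1-m_1\|^2_{P_1^{-1}},$$ where $\|z\|_M^2=z^\top Mz$, $Q_t$, $P_1$ and $R_t$ are positive semi-definite and invertible, and $A_t,B_t,H_t,G_{g,t},b_t,d_t,e_t,y_t,m_1$ are arbitrary. With $w_t=(w_{g,t})_g$, $\eta_t=(\bar\eta_t,(\eta_{g,t})_g)$, $\xi=(x,w,v,\eta)$, and any starting point $\xi^{(0)}$, an iteration of KS-mADMM computes the following. * $x^{(k+1)}$ is the smoothed mean of the augmented Kalman smoother (Kalman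 filter forward, Rauch–Tung–Striebel recursion backward) for the model with measurements $y_t\sim\mathcal N(H_tx_t+e_t,R_t)$, transitions $x_t\sim\mathcal N(\tilde A_tx_{t-1}+\tilde b_t,\tilde Q_t)$ and initial law $x_1\sim\mathcal N(\tilde m_1,\tilde P_1)$, where $\tilde Q_t=(Q_t^{-1}+\gamma I)^{-1}$, $\tilde A_t=\tilde Q_t(Q_t^{-1}A_t+\gamma B_t)$, $\tilde b_t=\tilde Q_t(Q_t^{-1}b_t+\gamma d_t+\gamma v_t^{(k)}-\bar\eta_t^{(k)})$, $\tilde P_1=(P_1^{-1}+\gamma I)^{-1}$, $\tilde m_1=\tilde P_1(P_1^{-1}m_1+\gamma d_1+\gamma v_1^{(k)}-\bar\eta_1^{(k)})$, and, for $t\ge2$, the additional pseudo-measurement of $x_{t-1}$ with value $d_t+v_t^{(k)}-\bar\eta_t^{(k)}/\gamma-b_t$, matrix $A_t-B_t$ and noise covariance $Q_t+\gamma^{-1}I$ (which has no effect when $B_t=A_t$). * $w_t^{(k+1)}$ minimises $\sum_g\mu\|w_{g,t}\|_2+\frac\gamma2\sum_g\|w_{g,t}-G_{g,t}v_t^{(k)}+\eta_{g,t}^{(k)}/\gamma\|_2^2$.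 * $v_t^{(k+1)}$ minimises $\frac\gamma2\big(\|u_t(x^{(k+1)})-v_t+\bar\eta_t^{(k)}/\gamma\|_2^2+\sum_g\|w_{g,t}^{(k+1)}-G_{g,t}v_t+\eta_{g,t}^{(k)}/\gamma\|_2^2\big)$. * $\bar\eta_t^{(k+1)}=\bar\eta_t^{(k)}+\gamma(u_t(x^{(k+1)})-v_t^{(k+1)})$ and $\eta_{g,t}^{(k+1)}=\eta_{g,t}^{(k)}+\gamma(w_{g,t}^{(k+1)}-G_{g,t}v_t^{(k+1)})$. Then each $x^{(k+1)}$ minimises the batch subproblem cost $f(x)+\frac\gamma2\sum_t\|u_t(x)-v_t^{(k)}+\bar\eta_t^{(k)}/\gamma\|_2^2$, and there is a point $\xi^\star=(x^\star,w^\star,v^\star,\eta^\star)$ such that 1. $x^{(k)}\to x^\star$, $w^{(k)}\to w^\star$, $v^{(k)}\to v^\star$, $\eta^{(k)}\to\eta^\star$; 2. $\xi^\star$ is a stationary (KKT) point of the split problem $\min f(x)+\sum_{t,g}\mu\|w_{g,t}\|_2$ subject to $u_t(x)=v_t$, $w_{g,t}=G_{g,t}v_t$: it is feasible, $\nabla_x\big(f(x)+\sum_t\bar\eta_t^{\star\top}u_t(x)\big)=0$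 at $x^\star$, $-\eta_{g,t}^\star$ is a subgradient of $\mu\|\cdot\|_2$ at $w_{g,t}^\star$, and $\bar\eta_t^\star+\sum_gG_{g,t}^\top\eta_{g,t}^\star=0$; and $x^\star$ is a global minimiser of the convex group Lasso problem; 3. (rates) write $\|\cdot\|_\Omega^2$ for the weighted norm of $s=(v,\eta)$ given by $\|(v,\eta)\|_\Omega^2=\gamma\sum_t\big(\|v_t\|_2^2+\sum_g\|G_{g,t}v_t\|_2^2\big)+\gamma^{-1}\sum_t\|\eta_t\|_2^2$, and $$\mathrm{gap}(\xi)=\Xi(\xi)-\Xi(\xi^\star)+(\xi-\xi^\star)^\top F(\xi^\star),\qquad \Xi(\xi)=f(x)+\sum_{t,g}\mu\|w_{g,t}\|_2,$$ where $F$ is the affine monotone map of the optimality system, so that $(\xi-\xi^\star)^\top F(\xi^\star)$ is $$\sum_t(u_t(x)-u_t(x^\star))^\top\bar\eta^\star_t+\sum_{t,g}(w_{g,t}-w_{g,t}^\star)^\top\eta^\star_{g,t}-\sum_t(v_t-v_t^\star)^\top\Big(\bar\eta_t^\star+\sum_gG_{g,t}^\top\eta_{g,t}^\star\Big)$$ $$-\sum_t\Big((\bar\eta_t-\bar\eta_t^\star)^\top(u_t(x^\star)-v_t^\star)+\sum_g(\eta_{g,t}-\eta_{g,t}^\star)^\top(w_{g,t}^\star-G_{g,t}v_t^\star)\Big).$$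 With the ergodic means $\bar\xi^{(j,k)}=\frac1{k+1}\sum_{i=0}^k\xi^{(j+i+1)}$, for all $j,k\ge0$, $$0\le \mathrm{gap}(\bar\xi^{(j,k)})\le\frac1{k+1}\|s^{(j)}-s^\star\|_\Omega^2,$$ and, as $k\to\infty$, $\mathrm{gap}(\bar\xi^{(k,k)})=o(1/k)$ and $\|s^{(k)}-s^{(k+1)}\|_\Omega^2=o(1/k)$. -/

import Mathlib

open Matrix Filter Topology Asymptotics

noncomputable section

/-- Data of the dynamic generalised group Lasso problem for an affine Gaussian state-space model with
`T = n + 1` time steps. Time is indexed by `Fin (n + 1)`, with `0` for the first time step; the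
data `A`, `b`, `Q`, `B` of the transition from time step `t.castSucc` to time step `t.succ` are
indexed by `t : Fin n`. The group `g` has the size `p g`. -/
structure GroupLasso (n Nx Ny Ng : ℕ) (p : Fin Ng → ℕ) where
  /-- measurements -/
  y : Fin (n + 1) → Fin Ny → ℝ
  /-- measurement matrices -/
  H : Fin (n + 1) → Matrix (Fin Ny) (Fin Nx) ℝ
  /-- measurement biases -/
  e : Fin (n + 1) → Fin Ny → ℝ
  /-- measurement noise covariances -/
  R : Fin (n + 1) → Matrix (Fin Ny) (Fin Ny) ℝ
  /-- transition matrices -/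
  A : Fin n → Matrix (Fin Nx) (Fin Nx) ℝ
  /-- transition biases -/
  b : Fin n → Fin Nx → ℝ
  /-- process noise covariances -/
  Q : Fin n → Matrix (Fin Nx) (Fin Nx) ℝ
  /-- initial mean -/
  m₁ : Fin Nx → ℝ
  /-- initial covariance -/
  P₁ : Matrix (Fin Nx) (Fin Nx) ℝ
  /-- group matrices -/
  G : (g : Fin Ng) → Fin (n + 1) → Matrix (Fin (p g)) (Fin Nx) ℝ
  /-- matrices of the sparsity model -/
  B : Fin n → Matrix (Fin Nx) (Fin Nx) ℝ
  /-- offsets of the sparsity model -/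
  d : Fin (n + 1) → Fin Nx → ℝ
  /-- regularisation weight -/
  μ : ℝ

/-- The Euclidean norm of a vector of reals. -/
def l2norm {m : ℕ} (z : Fin m → ℝ) : ℝ := ‖WithLp.toLp 2 z‖

/-- The squared weighted norm `‖z‖²_M = zᵀ M z`. -/
def wsq {m : ℕ} (M : Matrix (Fin m) (Fin m) ℝ) (z : Fin m → ℝ) : ℝ := z ⬝ᵥ (M *ᵥ z)

/-- One point `(x, w, v, η)`; the multiplier `η` has the part `etaU` for the constraints
`x_t - B_t x_{t-1} - d_t = v_t` and the part `etaW` for the constraints `w_{g,t} = G_{g,t} v_t`. -/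
structure Iterate (n Nx Ng : ℕ) (p : Fin Ng → ℕ) where
  x : Fin (n + 1) → Fin Nx → ℝ
  w : Fin (n + 1) → (g : Fin Ng) → Fin (p g) → ℝ
  v : Fin (n + 1) → Fin Nx → ℝ
  etaU : Fin (n + 1) → Fin Nx → ℝ
  etaW : Fin (n + 1) → (g : Fin Ng) → Fin (p g) → ℝ

namespace GroupLasso

variable {n Nx Ny Ng : ℕ} {p : Fin Ng → ℕ} (D : GroupLasso n Nx Ny Ng p)

/-- `u_t = x_t - B_t x_{t-1} - d_t`, where the term with `x_{t-1}` is absent at the first step. -/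
def u (x : Fin (n + 1) → Fin Nx → ℝ) (t : Fin (n + 1)) : Fin Nx → ℝ :=
  Fin.cases (motive := fun _ => Fin Nx → ℝ) (x 0 - D.d 0)
    (fun s => x s.succ - D.B s *ᵥ x s.castSucc - D.d s.succ) t

/-- The smooth part of the objective: measurement fit, dynamics, initial state. -/
def fit (x : Fin (n + 1) → Fin Nx → ℝ) : ℝ :=
  (1 / 2) * ∑ t, wsq (D.R t)⁻¹ (D.y t - (D.H t *ᵥ x t + D.e t))
    + (1 / 2) * ∑ t : Fin n, wsq (D.Q t)⁻¹ (x t.succ - (D.A t *ᵥ x t.castSucc + D.b t))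
    + (1 / 2) * wsq D.P₁⁻¹ (x 0 - D.m₁)

/-- The objective of the dynamic generalised group Lasso problem. -/
def objective (x : Fin (n + 1) → Fin Nx → ℝ) : ℝ :=
  D.fit x + ∑ t, ∑ g, D.μ * l2norm (D.G g t *ᵥ D.u x t)

/-! The augmented Kalman smoother -/

/-- Artificial process noise covariance. -/
def augQ (γ : ℝ) (t : Fin n) : Matrix (Fin Nx) (Fin Nx) ℝ := ((D.Q t)⁻¹ + γ • 1)⁻¹

/-- Artificial transition matrix. -/
def augA (γ : ℝ) (t : Fin n) : Matrix (Fin Nx) (Fin Nx) ℝ :=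
  D.augQ γ t * ((D.Q t)⁻¹ * D.A t + γ • D.B t)

/-- Artificial transition bias. -/
def augb (γ : ℝ) (v etaU : Fin (n + 1) → Fin Nx → ℝ) (t : Fin n) : Fin Nx → ℝ :=
  D.augQ γ t *ᵥ ((D.Q t)⁻¹ *ᵥ D.b t + γ • D.d t.succ + γ • v t.succ - etaU t.succ)

/-- Artificial initial covariance. -/
def augP₁ (γ : ℝ) : Matrix (Fin Nx) (Fin Nx) ℝ := (D.P₁⁻¹ + γ • 1)⁻¹

/-- Artificial initial mean. -/
def augm₁ (γ : ℝ) (v etaU : Fin (n + 1) → Fin Nx → ℝ) : Fin Nx → ℝ :=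
  D.augP₁ γ *ᵥ (D.P₁⁻¹ *ᵥ D.m₁ + γ • D.d 0 + γ • v 0 - etaU 0)

/-- Kalman measurement update of a predicted mean and covariance `q = (m⁻, P⁻)` at time `t`. -/
def ksUpdate (t : Fin (n + 1)) (q : (Fin Nx → ℝ) × Matrix (Fin Nx) (Fin Nx) ℝ) :
    (Fin Nx → ℝ) × Matrix (Fin Nx) (Fin Nx) ℝ :=
  let S := D.H t * q.2 * (D.H t)ᵀ + D.R t
  let K := q.2 * (D.H t)ᵀ * S⁻¹
  (q.1 + K *ᵥ (D.y t - (D.H t *ᵥ q.1 + D.e t)), q.2 - K * S * Kᵀ)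

/-- Kalman prediction of mean and covariance through the artificial transition `t`. -/
def ksPredict (γ : ℝ) (v etaU : Fin (n + 1) → Fin Nx → ℝ) (t : Fin n)
    (q : (Fin Nx → ℝ) × Matrix (Fin Nx) (Fin Nx) ℝ) :
    (Fin Nx → ℝ) × Matrix (Fin Nx) (Fin Nx) ℝ :=
  (D.augA γ t *ᵥ q.1 + D.augb γ v etaU t, D.augA γ t * q.2 * (D.augA γ t)ᵀ + D.augQ γ t)

/-- Kalman update of a filtered mean and covariance `q` at time `t.castSucc` with the
pseudo-measurement `(A_t - B_t) x + b_t - d_t - v_t + η_t / γ = 0` whose noise has the covariance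
`Q_t + γ⁻¹ I`. It carries the part of
`‖x' - A x - b‖²_{Q⁻¹} + γ ‖x' - B x - d - v + η / γ‖²` that depends on the old state `x` only and is
left over when the two terms are fused into one artificial transition; it does nothing when
`B_t = A_t`. -/
def ksPseudo (γ : ℝ) (v etaU : Fin (n + 1) → Fin Nx → ℝ) (t : Fin n)
    (q : (Fin Nx → ℝ) × Matrix (Fin Nx) (Fin Nx) ℝ) :
    (Fin Nx → ℝ) × Matrix (Fin Nx) (Fin Nx) ℝ :=
  let C := D.A t - D.B t
  let z := D.d t.succ + v t.succ - γ⁻¹ • etaU t.succ - D.b t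
  let S := C * q.2 * Cᵀ + (D.Q t + γ⁻¹ • 1)
  let K := q.2 * Cᵀ * S⁻¹
  (q.1 + K *ᵥ (z - C *ᵥ q.1), q.2 - K * S * Kᵀ)

theorem ksPseudo_eq_self (γ : ℝ) (v etaU : Fin (n + 1) → Fin Nx → ℝ) (t : Fin n)
    (q : (Fin Nx → ℝ) × Matrix (Fin Nx) (Fin Nx) ℝ) (h : D.B t = D.A t) :
    D.ksPseudo γ v etaU t q = q := by
  simp [ksPseudo, h]

/-- Filtered means and covariances (forward pass). -/
def ksFilter (γ : ℝ) (v etaU : Fin (n + 1) → Fin Nx → ℝ) (t : Fin (n + 1)) :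
    (Fin Nx → ℝ) × Matrix (Fin Nx) (Fin Nx) ℝ :=
  Fin.induction (motive := fun _ => (Fin Nx → ℝ) × Matrix (Fin Nx) (Fin Nx) ℝ)
    (D.ksUpdate 0 (D.augm₁ γ v etaU, D.augP₁ γ))
    (fun s q => D.ksUpdate s.succ (D.ksPredict γ v etaU s (D.ksPseudo γ v etaU s q))) t

/-- Smoothed means and covariances (backward pass). -/
def ksSmooth (γ : ℝ) (v etaU : Fin (n + 1) → Fin Nx → ℝ) (t : Fin (n + 1)) :
    (Fin Nx → ℝ) × Matrix (Fin Nx) (Fin Nx) ℝ :=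
  Fin.reverseInduction (motive := fun _ => (Fin Nx → ℝ) × Matrix (Fin Nx) (Fin Nx) ℝ)
    (D.ksFilter γ v etaU (Fin.last n))
    (fun s q =>
      let f := D.ksPseudo γ v etaU s (D.ksFilter γ v etaU s.castSucc)
      let f' := D.ksPredict γ v etaU s f
      let K := f.2 * (D.augA γ s)ᵀ * f'.2⁻¹
      (f.1 + K *ᵥ (q.1 - f'.1), f.2 + K * (q.2 - f'.2) * Kᵀ)) t

/-- The `x`-subproblem. -/
def xCost (γ : ℝ) (ξ : Iterate n Nx Ng p) (x : Fin (n + 1) → Fin Nx → ℝ) : ℝ :=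
  D.fit x + (γ / 2) * ∑ t, l2norm (D.u x t - ξ.v t + γ⁻¹ • ξ.etaU t) ^ 2

/-- The `w_t`-subproblem. -/
def wCost (γ : ℝ) (ξ : Iterate n Nx Ng p) (t : Fin (n + 1)) (w : (g : Fin Ng) → Fin (p g) → ℝ) :
    ℝ :=
  ∑ g, D.μ * l2norm (w g)
    + (γ / 2) * ∑ g, l2norm (w g - D.G g t *ᵥ ξ.v t + γ⁻¹ • ξ.etaW t g) ^ 2

/-- The `v_t`-subproblem, given the new `x` and `w` and the old multiplier. -/
def vCost (γ : ℝ) (ξ ξ' : Iterate n Nx Ng p) (t : Fin (n + 1)) (v : Fin Nx → ℝ) : ℝ :=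
  (γ / 2) * (l2norm (D.u ξ'.x t - v + γ⁻¹ • ξ.etaU t) ^ 2
    + ∑ g, l2norm (ξ'.w t g - D.G g t *ᵥ v + γ⁻¹ • ξ.etaW t g) ^ 2)

/-- `ξ'` is the result of one iteration of KS-mADMM with penalty parameter `γ` from `ξ`: the
`x`-update is computed by the augmented Kalman smoother. -/
structure KSmADMMStep (γ : ℝ) (ξ ξ' : Iterate n Nx Ng p) : Prop where
  x_update : ∀ t, ξ'.x t = (D.ksSmooth γ ξ.v ξ.etaU t).1
  w_update : ∀ t, IsMinOn (D.wCost γ ξ t) Set.univ (ξ'.w t)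
  v_update : ∀ t, IsMinOn (D.vCost γ ξ ξ' t) Set.univ (ξ'.v t)
  etaU_update : ∀ t, ξ'.etaU t = ξ.etaU t + γ • (D.u ξ'.x t - ξ'.v t)
  etaW_update : ∀ t g, ξ'.etaW t g = ξ.etaW t g + γ • (ξ'.w t g - D.G g t *ᵥ ξ'.v t)

/-- `ξ = (x, w, v, η)` is a stationary (Karush–Kuhn–Tucker) point of the problem of minimising
`fit x + ∑ μ ‖w_{g,t}‖₂` subject to `u_t = v_t` and `w_{g,t} = G_{g,t} v_t`. -/
structure IsStationary (ξ : Iterate n Nx Ng p) : Prop where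
  /-- feasibility -/
  feas_u : ∀ t, D.u ξ.x t = ξ.v t
  feas_w : ∀ t g, ξ.w t g = D.G g t *ᵥ ξ.v t
  /-- the derivative of the Lagrangian in `x` vanishes -/
  stat_x : HasFDerivAt (fun x => D.fit x + ∑ t, ξ.etaU t ⬝ᵥ D.u x t)
    (0 : (Fin (n + 1) → Fin Nx → ℝ) →L[ℝ] ℝ) ξ.x
  /-- `-η_{g,t}` is a subgradient of `μ ‖·‖₂` at `w_{g,t}` -/
  stat_w : ∀ t g (z : Fin (p g) → ℝ),
    D.μ * l2norm (ξ.w t g) + (-ξ.etaW t g) ⬝ᵥ (z - ξ.w t g) ≤ D.μ * l2norm z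
  /-- the derivative of the Lagrangian in `v` vanishes -/
  stat_v : ∀ t, ξ.etaU t + ∑ g, (D.G g t)ᵀ *ᵥ ξ.etaW t g = 0

/-- The objective `Ξ` of the split problem, as a function of `(x, w)`. -/
def splitObj (ξ : Iterate n Nx Ng p) : ℝ := D.fit ξ.x + ∑ t, ∑ g, D.μ * l2norm (ξ.w t g)

/-- The variational inequality gap `Ξ(ζ) - Ξ(ζ⋆) + (ξ - ξ⋆)ᵀ F(ξ⋆)`, where `ζ = (x, w)` and `F` is the
affine monotone map of the optimality system: the sums after the first line are the pairings with
its `x`-, `w`-, `v`- and `η`-component. -/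
def viGap (ξ ξs : Iterate n Nx Ng p) : ℝ :=
  D.splitObj ξ - D.splitObj ξs
    + ∑ t, (D.u ξ.x t - D.u ξs.x t) ⬝ᵥ ξs.etaU t
    + ∑ t, ∑ g, (ξ.w t g - ξs.w t g) ⬝ᵥ ξs.etaW t g
    - ∑ t, (ξ.v t - ξs.v t) ⬝ᵥ (ξs.etaU t + ∑ g, (D.G g t)ᵀ *ᵥ ξs.etaW t g)
    - ∑ t, ((ξ.etaU t - ξs.etaU t) ⬝ᵥ (D.u ξs.x t - ξs.v t)
        + ∑ g, (ξ.etaW t g - ξs.etaW t g) ⬝ᵥ (ξs.w t g - D.G g t *ᵥ ξs.v t))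

/-- The squared `Ω`-norm of the difference of the `(v, η)`-parts of two points, for
`Ω = diag(γ (I + Gᵀ G), I / γ)`. -/
def omegaDistSq (γ : ℝ) (ξ ξ' : Iterate n Nx Ng p) : ℝ :=
  γ * ∑ t, (l2norm (ξ.v t - ξ'.v t) ^ 2 + ∑ g, l2norm (D.G g t *ᵥ (ξ.v t - ξ'.v t)) ^ 2)
    + γ⁻¹ * ∑ t, (l2norm (ξ.etaU t - ξ'.etaU t) ^ 2 + ∑ g, l2norm (ξ.etaW t g - ξ'.etaW t g) ^ 2)

end GroupLasso

/-- The mean of the `k + 1` points `ξ^(j+1), …, ξ^(j+k+1)`. -/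
def Iterate.mean {n Nx Ng : ℕ} {p : Fin Ng → ℕ} (ξ : ℕ → Iterate n Nx Ng p) (j k : ℕ) :
    Iterate n Nx Ng p where
  x := ((k : ℝ) + 1)⁻¹ • ∑ i ∈ Finset.range (k + 1), (ξ (j + i + 1)).x
  w := ((k : ℝ) + 1)⁻¹ • ∑ i ∈ Finset.range (k + 1), (ξ (j + i + 1)).w
  v := ((k : ℝ) + 1)⁻¹ • ∑ i ∈ Finset.range (k + 1), (ξ (j + i + 1)).v
  etaU := ((k : ℝ) + 1)⁻¹ • ∑ i ∈ Finset.range (k + 1), (ξ (j + i + 1)).etaU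
  etaW := ((k : ℝ) + 1)⁻¹ • ∑ i ∈ Finset.range (k + 1), (ξ (j + i + 1)).etaW

end

noncomputable section

/-! The Kalman part is repeated completion of squares. Dynamics and penalty at one time step are two
quadratics in the new state; `wsq_fuse` turns them into the artificial transition plus a remainder
in the old state alone, which is the pseudo-measurement. With `wsq_conditioning` at each prediction
and `wsq_update` at each measurement, twice the batch cost becomes a constant plus nonnegative
squares (`xCost_eq_wsq`). The backward recursion makes every square vanish, so the smoothed mean is
a minimiser (`isMinOn_xCost`).

The x- and w-updates both use the old `v` and do not interact. So the iteration is two-block ADMM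
with blocks `(x, w)` and `v` and the single constraint `(u x, w) = S v`, where `S v = (v, G v)`.
`KSmADMMStep.isADMMStep` reduces it to three facts: criticality of `(x, w)` at a shifted multiplier,
`Sᵀ η' = 0`, and the multiplier update.

Any two such steps satisfy an exact energy identity for the Ω-distance
(`IsADMMStep.energy_identity`). Its right side is a monotone pairing, nonnegative by convexity, plus
a perfect square. Hence steps are nonexpansive, distances to KKT points decrease, and the decrement
dominates twice the gap and, after the first iteration, the squared step length.

A KKT point exists by maximising the dual function over the compact product of balls of radius `μ`
(`exists_isKKT`). Convergence is then a Fejér argument: iterates are bounded, steps vanish, a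
cluster point is KKT, and the antitone distance to it tends to zero. The rates follow from
telescoping: Jensen's inequality for the ergodic gap, antitonicity for the step lengths. -/

theorem l2norm_sq {m : ℕ} (z : Fin m → ℝ) : l2norm z ^ 2 = z ⬝ᵥ z := by
  rw [l2norm, EuclideanSpace.real_norm_sq_eq]
  simp [dotProduct, sq]

/-! ### Algebra of weighted quadratic forms -/

theorem wsq_neg {m : ℕ} (M : Matrix (Fin m) (Fin m) ℝ) (z : Fin m → ℝ) : wsq M (-z) = wsq M z := by
  simp [wsq, mulVec_neg]

theorem wsq_nonneg {m : ℕ} {M : Matrix (Fin m) (Fin m) ℝ} (hM : M.PosSemidef) (z : Fin m → ℝ) :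
    0 ≤ wsq M z := by
  simpa [wsq] using hM.dotProduct_mulVec_nonneg z

theorem wsq_smul_one {m : ℕ} (γ : ℝ) (z : Fin m → ℝ) : wsq (γ • 1) z = γ * l2norm z ^ 2 := by
  simp [wsq, l2norm_sq, smul_mulVec]

theorem dotProduct_mulVec_comm_of_isHermitian {m : ℕ} {M : Matrix (Fin m) (Fin m) ℝ}
    (hM : M.IsHermitian) (z w : Fin m → ℝ) : z ⬝ᵥ (M *ᵥ w) = w ⬝ᵥ (M *ᵥ z) := by
  have hM' : Mᵀ = M := by simpa [conjTranspose_eq_transpose_of_trivial] using hM.eq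
  rw [dotProduct_mulVec, ← mulVec_transpose, hM', dotProduct_comm]

theorem wsq_add {m : ℕ} {M : Matrix (Fin m) (Fin m) ℝ} (hM : M.IsHermitian) (z w : Fin m → ℝ) :
    wsq M (z + w) = wsq M z + 2 * (w ⬝ᵥ (M *ᵥ z)) + wsq M w := by
  simp only [wsq, mulVec_add, dotProduct_add, add_dotProduct]
  rw [dotProduct_mulVec_comm_of_isHermitian hM z w]; ring

theorem wsq_sub {m : ℕ} {M : Matrix (Fin m) (Fin m) ℝ} (hM : M.IsHermitian) (z w : Fin m → ℝ) :
    wsq M (z - w) = wsq M z - 2 * (w ⬝ᵥ (M *ᵥ z)) + wsq M w := by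
  rw [sub_eq_add_neg, wsq_add hM, wsq_neg, neg_dotProduct]; ring

theorem wsq_mulVec {m l : ℕ} (M : Matrix (Fin m) (Fin m) ℝ) (C : Matrix (Fin m) (Fin l) ℝ)
    (z : Fin l → ℝ) : wsq M (C *ᵥ z) = wsq (Cᵀ * M * C) z := by
  simp only [wsq, ← mulVec_mulVec]
  rw [dotProduct_comm, dotProduct_mulVec, ← mulVec_transpose]
  rw [mulVec_mulVec, dotProduct_comm, mulVec_mulVec]

/-! ### Gaussian conditioning by completing the square -/

section Conditioning

variable {m l : ℕ} {P : Matrix (Fin m) (Fin m) ℝ} {R : Matrix (Fin l) (Fin l) ℝ}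

theorem posDef_innovation (hP : P.PosSemidef) (hR : R.PosDef) (H : Matrix (Fin l) (Fin m) ℝ) :
    (H * P * Hᵀ + R).PosDef := by
  have := hP.mul_mul_conjTranspose_same H
  rw [conjTranspose_eq_transpose_of_trivial] at this
  exact PosDef.posSemidef_add this hR

theorem posDef_information (hP : P.PosDef) (hR : R.PosSemidef) (H : Matrix (Fin l) (Fin m) ℝ) :
    (P + Hᵀ * R * H).PosDef := by
  have := hR.conjTranspose_mul_mul_same H
  rw [conjTranspose_eq_transpose_of_trivial] at this
  exact hP.add_posSemidef this

/-- The information matrix times the Kalman gain. -/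
theorem information_mul_gain (hP : P.PosDef) (hR : R.PosDef) (H : Matrix (Fin l) (Fin m) ℝ) :
    (P⁻¹ + Hᵀ * R⁻¹ * H) * (P * Hᵀ * (H * P * Hᵀ + R)⁻¹) = Hᵀ * R⁻¹ := by
  have hS := (posDef_innovation hP.posSemidef hR H).isUnit
  have hSd := (isUnit_iff_isUnit_det _).1 hS
  have hPd := (isUnit_iff_isUnit_det _).1 hP.isUnit
  have hRd := (isUnit_iff_isUnit_det _).1 hR.isUnit
  -- Push-through identity: both sides equal `Hᵀ + Hᵀ R⁻¹ H P Hᵀ`.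
  have h1 : (P⁻¹ + Hᵀ * R⁻¹ * H) * (P * Hᵀ) = Hᵀ * R⁻¹ * (H * P * Hᵀ + R) := by
    rw [Matrix.add_mul, Matrix.mul_add, ← Matrix.mul_assoc P⁻¹, nonsing_inv_mul _ hPd,
      Matrix.mul_assoc Hᵀ R⁻¹ R, nonsing_inv_mul _ hRd]
    simp only [Matrix.one_mul, Matrix.mul_one, Matrix.mul_assoc]
    rw [add_comm]
  rw [← Matrix.mul_assoc, h1, Matrix.mul_assoc, mul_nonsing_inv _ hSd, Matrix.mul_one]

theorem gain_transpose (hP : P.PosDef) (hR : R.PosDef) (H : Matrix (Fin l) (Fin m) ℝ) :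
    (P * Hᵀ * (H * P * Hᵀ + R)⁻¹)ᵀ = (H * P * Hᵀ + R)⁻¹ * H * P := by
  have hS := (posDef_innovation hP.posSemidef hR H).isHermitian.inv.eq
  have hP' := hP.isHermitian.eq
  rw [conjTranspose_eq_transpose_of_trivial] at hS hP'
  rw [transpose_mul, transpose_mul, hS, hP', transpose_transpose, ← Matrix.mul_assoc]

/-- The Woodbury identity for the Kalman update of the covariance. -/
theorem information_mul_covariance (hP : P.PosDef) (hR : R.PosDef)
    (H : Matrix (Fin l) (Fin m) ℝ) :
    (P⁻¹ + Hᵀ * R⁻¹ * H) * (P - P * Hᵀ * (H * P * Hᵀ + R)⁻¹ * (H * P * Hᵀ + R) *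
      (P * Hᵀ * (H * P * Hᵀ + R)⁻¹)ᵀ) = 1 := by
  have hSd := (isUnit_iff_isUnit_det _).1 (posDef_innovation hP.posSemidef hR H).isUnit
  have hPd := (isUnit_iff_isUnit_det _).1 hP.isUnit
  rw [mul_sub, Matrix.mul_assoc (P * Hᵀ * (H * P * Hᵀ + R)⁻¹), ← Matrix.mul_assoc,
    information_mul_gain hP hR, gain_transpose hP hR, Matrix.mul_assoc _ H P,
    ← Matrix.mul_assoc (H * P * Hᵀ + R) _ (H * P), mul_nonsing_inv _ hSd, Matrix.one_mul, add_mul,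
    nonsing_inv_mul _ hPd]
  simp only [Matrix.mul_assoc]
  abel

theorem inv_information (hP : P.PosDef) (hR : R.PosDef) (H : Matrix (Fin l) (Fin m) ℝ) :
    (P⁻¹ + Hᵀ * R⁻¹ * H)⁻¹ = P - P * Hᵀ * (H * P * Hᵀ + R)⁻¹ * (H * P * Hᵀ + R) *
      (P * Hᵀ * (H * P * Hᵀ + R)⁻¹)ᵀ :=
  inv_eq_right_inv (information_mul_covariance hP hR H)

theorem posDef_update (hP : P.PosDef) (hR : R.PosDef) (H : Matrix (Fin l) (Fin m) ℝ) :
    (P - P * Hᵀ * (H * P * Hᵀ + R)⁻¹ * (H * P * Hᵀ + R) *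
      (P * Hᵀ * (H * P * Hᵀ + R)⁻¹)ᵀ).PosDef := by
  rw [← inv_information hP hR]
  exact (posDef_information hP.inv hR.inv.posSemidef H).inv

/-- The joint density of a Gaussian vector and a linear measurement of it, factored into the
marginal density of the measurement and the conditional density of the vector. -/
theorem wsq_conditioning (hP : P.PosDef) (hR : R.PosDef) (H : Matrix (Fin l) (Fin m) ℝ)
    (x : Fin m → ℝ) (z : Fin l → ℝ) :
    wsq P⁻¹ x + wsq R⁻¹ (z - H *ᵥ x) = wsq (H * P * Hᵀ + R)⁻¹ z
      + wsq (P⁻¹ + Hᵀ * R⁻¹ * H) (x - (P * Hᵀ * (H * P * Hᵀ + R)⁻¹) *ᵥ z) := by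
  have hSd := (isUnit_iff_isUnit_det _).1 (posDef_innovation hP.posSemidef hR H).isUnit
  have hRd := (isUnit_iff_isUnit_det _).1 hR.isUnit
  have hW := information_mul_gain hP hR H
  have hKt := gain_transpose hP hR H
  have hPos := (posDef_information hP.inv hR.inv.posSemidef H)
  have hWadd : wsq (P⁻¹ + Hᵀ * R⁻¹ * H) x = wsq P⁻¹ x + wsq R⁻¹ (H *ᵥ x) := by
    rw [wsq_mulVec]; simp only [wsq, add_mulVec, dotProduct_add]
  set S := H * P * Hᵀ + R with hS
  set K := P * Hᵀ * S⁻¹ with hK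
  -- Completing the square in `x` uses up this part of `wsq R⁻¹ z`; the marginal weight `S⁻¹` is
  -- what remains.
  have hKWK : Kᵀ * (P⁻¹ + Hᵀ * R⁻¹ * H) * K = R⁻¹ - S⁻¹ := by
    have : H * P * Hᵀ = S - R := by rw [hS]; abel
    rw [Matrix.mul_assoc, hW, hKt, ← Matrix.mul_assoc, Matrix.mul_assoc _ H P,
      Matrix.mul_assoc _ _ Hᵀ, this, mul_sub, nonsing_inv_mul _ hSd, sub_mul, Matrix.one_mul,
      Matrix.mul_assoc, mul_nonsing_inv _ hRd, Matrix.mul_one]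
  rw [wsq_sub hR.isHermitian.inv, wsq_sub hPos.isHermitian, wsq_mulVec _ K, hKWK, hWadd]
  rw [dotProduct_mulVec_comm_of_isHermitian hPos.isHermitian, mulVec_mulVec, hW]
  have h2 : wsq (R⁻¹ - S⁻¹) z = wsq R⁻¹ z - wsq S⁻¹ z := by
    simp only [wsq, sub_mulVec, dotProduct_sub]
  have h3 : x ⬝ᵥ ((Hᵀ * R⁻¹) *ᵥ z) = (H *ᵥ x) ⬝ᵥ (R⁻¹ *ᵥ z) := by
    rw [← mulVec_mulVec, dotProduct_mulVec, vecMul_transpose]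
  rw [h2, h3]; ring

/-- The Kalman update, as an identity between quadratic costs. -/
theorem wsq_update (hP : P.PosDef) (hR : R.PosDef) (H : Matrix (Fin l) (Fin m) ℝ)
    (a x : Fin m → ℝ) (z : Fin l → ℝ) :
    wsq P⁻¹ (x - a) + wsq R⁻¹ (z - H *ᵥ x) = wsq (H * P * Hᵀ + R)⁻¹ (z - H *ᵥ a)
      + wsq (P - P * Hᵀ * (H * P * Hᵀ + R)⁻¹ * (H * P * Hᵀ + R) *
          (P * Hᵀ * (H * P * Hᵀ + R)⁻¹)ᵀ)⁻¹
        (x - (a + (P * Hᵀ * (H * P * Hᵀ + R)⁻¹) *ᵥ (z - H *ᵥ a))) := by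
  rw [← inv_information hP hR, nonsing_inv_nonsing_inv _ ((isUnit_iff_isUnit_det _).1
    (posDef_information hP.inv hR.inv.posSemidef H).isUnit)]
  have := wsq_conditioning hP hR H (x - a) (z - H *ᵥ a)
  rw [mulVec_sub] at this
  rw [← sub_sub, ← this]
  congr 2; abel

/-- The product of two Gaussian densities of the same vector. -/
theorem wsq_fuse {M N : Matrix (Fin m) (Fin m) ℝ} (hM : M.PosDef) (hN : N.PosDef)
    (x a c : Fin m → ℝ) :
    wsq M (x - a) + wsq N (x - c)
      = wsq (M + N) (x - (M + N)⁻¹ *ᵥ (M *ᵥ a + N *ᵥ c)) + wsq (M⁻¹ + N⁻¹)⁻¹ (c - a) := by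
  have hMd := (isUnit_iff_isUnit_det _).1 hM.isUnit
  have hNd := (isUnit_iff_isUnit_det _).1 hN.isUnit
  have hWd := (isUnit_iff_isUnit_det _).1 (hM.add hN).isUnit
  -- Fusion is conditioning with identity measurement matrix: prior centred at `a`, measured value
  -- `c`, covariances `M⁻¹` and `N⁻¹`.
  have h := wsq_conditioning hM.inv hN.inv 1 (x - a) (c - a)
  have hW := information_mul_gain hM.inv hN.inv 1
  simp only [nonsing_inv_nonsing_inv _ hMd, nonsing_inv_nonsing_inv _ hNd, transpose_one,
    Matrix.one_mul, Matrix.mul_one, one_mulVec] at h hW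
  have hK : M⁻¹ * (M⁻¹ + N⁻¹)⁻¹ = (M + N)⁻¹ * N := by
    rw [← Matrix.one_mul (M⁻¹ * _), ← nonsing_inv_mul _ hWd, Matrix.mul_assoc, hW]
  have h1 : (M + N)⁻¹ *ᵥ (M *ᵥ a + N *ᵥ c) = a + ((M + N)⁻¹ * N) *ᵥ (c - a) := by
    have : M *ᵥ a + N *ᵥ c = (M + N) *ᵥ a + N *ᵥ (c - a) := by
      rw [add_mulVec, mulVec_sub]; abel
    rw [this, mulVec_add, mulVec_mulVec, nonsing_inv_mul _ hWd, one_mulVec, mulVec_mulVec]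
  rw [hK] at h
  rw [h1, ← sub_sub, add_comm (wsq (M + N) _), ← h, ← wsq_neg N (x - c)]
  congr 2; abel

end Conditioning

/-! ### The augmented Kalman smoother minimises the batch cost -/

namespace GroupLasso

variable {n Nx Ny Ng : ℕ} {p : Fin Ng → ℕ} (D : GroupLasso n Nx Ny Ng p)

/-- The covariances are positive definite. -/
structure PosDefCov : Prop where
  R : ∀ t, (D.R t).PosDef
  Q : ∀ t, (D.Q t).PosDef
  P₁ : D.P₁.PosDef

theorem u_zero (x : Fin (n + 1) → Fin Nx → ℝ) : D.u x 0 = x 0 - D.d 0 := rfl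

theorem u_succ (x : Fin (n + 1) → Fin Nx → ℝ) (s : Fin n) :
    D.u x s.succ = x s.succ - D.B s *ᵥ x s.castSucc - D.d s.succ := rfl

theorem posDef_smul_one {m : ℕ} {γ : ℝ} (hγ : 0 < γ) :
    (γ • (1 : Matrix (Fin m) (Fin m) ℝ)).PosDef := PosDef.one.smul hγ

theorem inv_smul_one {m : ℕ} {γ : ℝ} (hγ : 0 < γ) :
    (γ • (1 : Matrix (Fin m) (Fin m) ℝ))⁻¹ = γ⁻¹ • 1 :=
  inv_eq_right_inv (by simp [hγ.ne'])

variable {D} (hD : D.PosDefCov) {γ : ℝ} (hγ : 0 < γ) (v etaU : Fin (n + 1) → Fin Nx → ℝ)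
include hD

theorem posDef_ksUpdate (t : Fin (n + 1)) {q : (Fin Nx → ℝ) × Matrix (Fin Nx) (Fin Nx) ℝ}
    (hq : q.2.PosDef) : (D.ksUpdate t q).2.PosDef :=
  posDef_update hq (hD.R t) (D.H t)

theorem wsq_ksUpdate (t : Fin (n + 1)) {q : (Fin Nx → ℝ) × Matrix (Fin Nx) (Fin Nx) ℝ}
    (hq : q.2.PosDef) : ∃ c, ∀ x : Fin Nx → ℝ,
      wsq q.2⁻¹ (x - q.1) + wsq (D.R t)⁻¹ (D.y t - (D.H t *ᵥ x + D.e t))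
        = c + wsq (D.ksUpdate t q).2⁻¹ (x - (D.ksUpdate t q).1) := by
  refine ⟨wsq (D.H t * q.2 * (D.H t)ᵀ + D.R t)⁻¹ (D.y t - D.e t - D.H t *ᵥ q.1), fun x => ?_⟩
  have h := wsq_update hq (hD.R t) (D.H t) q.1 x (D.y t - D.e t)
  have e : ∀ z : Fin Nx → ℝ, D.y t - (D.H t *ᵥ z + D.e t) = D.y t - D.e t - D.H t *ᵥ z :=
    fun z => by abel
  rw [e, h]
  simp only [ksUpdate, e]

include hγ

theorem posDef_augQ (t : Fin n) : (D.augQ γ t).PosDef :=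
  ((hD.Q t).inv.add (posDef_smul_one hγ)).inv

theorem posDef_augP₁ : (D.augP₁ γ).PosDef := (hD.P₁.inv.add (posDef_smul_one hγ)).inv

theorem posDef_ksPseudo (t : Fin n) {q : (Fin Nx → ℝ) × Matrix (Fin Nx) (Fin Nx) ℝ}
    (hq : q.2.PosDef) : (D.ksPseudo γ v etaU t q).2.PosDef :=
  posDef_update hq ((hD.Q t).add (posDef_smul_one (inv_pos.2 hγ))) (D.A t - D.B t)

theorem wsq_ksPseudo (t : Fin n) {q : (Fin Nx → ℝ) × Matrix (Fin Nx) (Fin Nx) ℝ}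
    (hq : q.2.PosDef) : ∃ c, ∀ x : Fin Nx → ℝ,
      wsq q.2⁻¹ (x - q.1) + wsq (D.Q t + γ⁻¹ • 1)⁻¹
          (D.d t.succ + v t.succ - γ⁻¹ • etaU t.succ - D.b t - (D.A t - D.B t) *ᵥ x)
        = c + wsq (D.ksPseudo γ v etaU t q).2⁻¹ (x - (D.ksPseudo γ v etaU t q).1) :=
  ⟨_, fun x => wsq_update hq ((hD.Q t).add (posDef_smul_one (inv_pos.2 hγ))) (D.A t - D.B t) q.1 x _⟩

theorem posDef_ksPredict (t : Fin n) {q : (Fin Nx → ℝ) × Matrix (Fin Nx) (Fin Nx) ℝ}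
    (hq : q.2.PosDef) : (D.ksPredict γ v etaU t q).2.PosDef :=
  posDef_innovation hq.posSemidef (posDef_augQ hD hγ t) _

theorem wsq_ksPredict (t : Fin n) {q : (Fin Nx → ℝ) × Matrix (Fin Nx) (Fin Nx) ℝ}
    (hq : q.2.PosDef) (x x' : Fin Nx → ℝ) :
    wsq q.2⁻¹ (x - q.1) + wsq (D.augQ γ t)⁻¹ (x' - (D.augA γ t *ᵥ x + D.augb γ v etaU t))
      = wsq (D.ksPredict γ v etaU t q).2⁻¹ (x' - (D.ksPredict γ v etaU t q).1)
        + wsq (q.2⁻¹ + (D.augA γ t)ᵀ * (D.augQ γ t)⁻¹ * D.augA γ t)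
          (x - (q.1 + (q.2 * (D.augA γ t)ᵀ * (D.ksPredict γ v etaU t q).2⁻¹) *ᵥ
            (x' - (D.ksPredict γ v etaU t q).1))) := by
  have h := wsq_conditioning hq (posDef_augQ hD hγ t) (D.augA γ t) (x - q.1)
    (x' - (D.ksPredict γ v etaU t q).1)
  rw [← sub_sub x q.1]
  refine Eq.trans ?_ h
  congr 2
  simp only [ksPredict, mulVec_sub]; abel

/-- The dynamics and the penalty at a time step, fused into the artificial transition and the
pseudo-measurement. -/
theorem wsq_transition (t : Fin n) (x : Fin (n + 1) → Fin Nx → ℝ) :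
    wsq (D.Q t)⁻¹ (x t.succ - (D.A t *ᵥ x t.castSucc + D.b t))
        + γ * l2norm (D.u x t.succ - v t.succ + γ⁻¹ • etaU t.succ) ^ 2
      = wsq (D.augQ γ t)⁻¹ (x t.succ - (D.augA γ t *ᵥ x t.castSucc + D.augb γ v etaU t))
        + wsq (D.Q t + γ⁻¹ • 1)⁻¹ (D.d t.succ + v t.succ - γ⁻¹ • etaU t.succ - D.b t
            - (D.A t - D.B t) *ᵥ x t.castSucc) := by
  have hpd := (hD.Q t).inv.add (posDef_smul_one (m := Nx) hγ)
  -- The two centres for the new state are the one predicted by the dynamics and the one preferred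
  -- by the penalty. Their difference depends on the old state only, with weight `(Q + γ⁻¹ I)⁻¹`.
  have h := wsq_fuse (hD.Q t).inv (posDef_smul_one hγ) (x t.succ)
    (D.A t *ᵥ x t.castSucc + D.b t)
    (D.B t *ᵥ x t.castSucc + D.d t.succ + v t.succ - γ⁻¹ • etaU t.succ)
  rw [inv_smul_one hγ, nonsing_inv_nonsing_inv _ ((isUnit_iff_isUnit_det _).1 (hD.Q t).isUnit),
    wsq_smul_one] at h
  have e1 : D.u x t.succ - v t.succ + γ⁻¹ • etaU t.succ = x t.succ -
      (D.B t *ᵥ x t.castSucc + D.d t.succ + v t.succ - γ⁻¹ • etaU t.succ) := by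
    rw [u_succ]; abel
  rw [e1, h, augQ, nonsing_inv_nonsing_inv _ ((isUnit_iff_isUnit_det _).1 hpd.isUnit)]
  congr 2
  · congr 1
    simp only [augA, augb, augQ]
    rw [← mulVec_mulVec, ← mulVec_add]
    congr 1
    simp only [add_mulVec, mulVec_add, ← mulVec_mulVec, smul_mulVec, one_mulVec, smul_add, smul_sub,
      smul_smul, mul_inv_cancel₀ hγ.ne', one_smul]
    abel
  · rw [sub_mulVec]; abel

/-- At the first time step both centres are fixed data, so the remainder of the fusion is a constant
and no pseudo-measurement is needed. -/
theorem wsq_initial (x : Fin (n + 1) → Fin Nx → ℝ) :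
    wsq D.P₁⁻¹ (x 0 - D.m₁) + γ * l2norm (D.u x 0 - v 0 + γ⁻¹ • etaU 0) ^ 2
      = wsq (D.augP₁ γ)⁻¹ (x 0 - D.augm₁ γ v etaU)
        + wsq (D.P₁ + γ⁻¹ • 1)⁻¹ (D.d 0 + v 0 - γ⁻¹ • etaU 0 - D.m₁) := by
  have hpd := hD.P₁.inv.add (posDef_smul_one (m := Nx) hγ)
  have h := wsq_fuse hD.P₁.inv (posDef_smul_one hγ) (x 0) D.m₁ (D.d 0 + v 0 - γ⁻¹ • etaU 0)
  rw [inv_smul_one hγ, nonsing_inv_nonsing_inv _ ((isUnit_iff_isUnit_det _).1 hD.P₁.isUnit),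
    wsq_smul_one] at h
  have e1 : D.u x 0 - v 0 + γ⁻¹ • etaU 0 = x 0 - (D.d 0 + v 0 - γ⁻¹ • etaU 0) := by
    rw [u_zero]; abel
  rw [e1, h, augP₁, nonsing_inv_nonsing_inv _ ((isUnit_iff_isUnit_det _).1 hpd.isUnit)]
  congr 2
  congr 1
  simp only [augm₁, augP₁]
  congr 1
  simp only [smul_mulVec, one_mulVec, smul_add, smul_sub, smul_smul, mul_inv_cancel₀ hγ.ne',
    one_smul]
  abel

omit hD hγ in
theorem ksFilter_zero : D.ksFilter γ v etaU 0
    = D.ksUpdate 0 (D.augm₁ γ v etaU, D.augP₁ γ) := rfl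

omit hD hγ in
theorem ksFilter_succ (s : Fin n) : D.ksFilter γ v etaU s.succ
    = D.ksUpdate s.succ (D.ksPredict γ v etaU s
        (D.ksPseudo γ v etaU s (D.ksFilter γ v etaU s.castSucc))) := by
  simp [ksFilter]

theorem posDef_ksFilter (t : Fin (n + 1)) : (D.ksFilter γ v etaU t).2.PosDef := by
  induction t using Fin.induction with
  | zero => exact posDef_ksUpdate hD 0 (posDef_augP₁ hD hγ)
  | succ s ih =>
    rw [ksFilter_succ]
    exact posDef_ksUpdate hD _ (posDef_ksPredict hD hγ _ _ _ (posDef_ksPseudo hD hγ _ _ _ ih))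

omit hD hγ in
theorem ksSmooth_last : D.ksSmooth γ v etaU (Fin.last n) = D.ksFilter γ v etaU (Fin.last n) := by
  simp [ksSmooth]

omit hD hγ in
-- The recursion of the means is closed: smoothed covariances do not enter it.
theorem ksSmooth_castSucc_fst (s : Fin n) : (D.ksSmooth γ v etaU s.castSucc).1
    = (D.ksPseudo γ v etaU s (D.ksFilter γ v etaU s.castSucc)).1
      + ((D.ksPseudo γ v etaU s (D.ksFilter γ v etaU s.castSucc)).2 * (D.augA γ s)ᵀ *
          (D.ksPredict γ v etaU s (D.ksPseudo γ v etaU s (D.ksFilter γ v etaU s.castSucc))).2⁻¹) *ᵥ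
        ((D.ksSmooth γ v etaU s.succ).1
          - (D.ksPredict γ v etaU s (D.ksPseudo γ v etaU s (D.ksFilter γ v etaU s.castSucc))).1) := by
  simp [ksSmooth]

/-- One step of the filter, as an identity between quadratic costs. -/
theorem wsq_filter_step (s : Fin n) : ∃ c, ∀ x : Fin (n + 1) → Fin Nx → ℝ,
    wsq (D.ksFilter γ v etaU s.castSucc).2⁻¹ (x s.castSucc - (D.ksFilter γ v etaU s.castSucc).1)
        + wsq (D.Q s)⁻¹ (x s.succ - (D.A s *ᵥ x s.castSucc + D.b s))
        + γ * l2norm (D.u x s.succ - v s.succ + γ⁻¹ • etaU s.succ) ^ 2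
        + wsq (D.R s.succ)⁻¹ (D.y s.succ - (D.H s.succ *ᵥ x s.succ + D.e s.succ))
      = c + wsq (D.ksFilter γ v etaU s.succ).2⁻¹ (x s.succ - (D.ksFilter γ v etaU s.succ).1)
        + wsq ((D.ksPseudo γ v etaU s (D.ksFilter γ v etaU s.castSucc)).2⁻¹
            + (D.augA γ s)ᵀ * (D.augQ γ s)⁻¹ * D.augA γ s)
          (x s.castSucc - ((D.ksPseudo γ v etaU s (D.ksFilter γ v etaU s.castSucc)).1
            + ((D.ksPseudo γ v etaU s (D.ksFilter γ v etaU s.castSucc)).2 * (D.augA γ s)ᵀ *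
          (D.ksPredict γ v etaU s (D.ksPseudo γ v etaU s (D.ksFilter γ v etaU s.castSucc))).2⁻¹) *ᵥ
        (x s.succ - (D.ksPredict γ v etaU s
          (D.ksPseudo γ v etaU s (D.ksFilter γ v etaU s.castSucc))).1))) := by
  have hf := posDef_ksFilter hD hγ v etaU s.castSucc
  have hf' := posDef_ksPseudo hD hγ v etaU s hf
  obtain ⟨c₁, h₁⟩ := wsq_ksPseudo hD hγ v etaU s hf
  obtain ⟨c₂, h₂⟩ := wsq_ksUpdate hD s.succ (posDef_ksPredict hD hγ v etaU s hf')
  refine ⟨c₁ + c₂, fun x => ?_⟩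
  have h₃ := wsq_ksPredict hD hγ v etaU s hf' (x s.castSucc) (x s.succ)
  have h₄ := wsq_transition hD hγ v etaU s x
  rw [ksFilter_succ]
  -- `h₄` fuses dynamics and penalty, `h₁` absorbs the pseudo-measurement, `h₃` predicts and `h₂`
  -- absorbs the measurement.
  linarith [h₁ (x s.castSucc), h₂ (x s.succ)]

/-- Summing the filter steps telescopes the filtered costs. What survives is the last one and, for
each transition, a square measuring the failure of the backward recursion. -/
theorem xCost_eq_wsq : ∃ c, ∃ W : Fin n → Matrix (Fin Nx) (Fin Nx) ℝ, (∀ s, (W s).PosSemidef) ∧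
    ∀ (ξ : Iterate n Nx Ng p), ξ.v = v → ξ.etaU = etaU → ∀ x : Fin (n + 1) → Fin Nx → ℝ,
      2 * D.xCost γ ξ x = c
        + wsq (D.ksFilter γ v etaU (Fin.last n)).2⁻¹
            (x (Fin.last n) - (D.ksFilter γ v etaU (Fin.last n)).1)
        + ∑ s, wsq (W s)
          (x s.castSucc - ((D.ksPseudo γ v etaU s (D.ksFilter γ v etaU s.castSucc)).1
            + ((D.ksPseudo γ v etaU s (D.ksFilter γ v etaU s.castSucc)).2 * (D.augA γ s)ᵀ *
          (D.ksPredict γ v etaU s (D.ksPseudo γ v etaU s (D.ksFilter γ v etaU s.castSucc))).2⁻¹) *ᵥ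
        (x s.succ - (D.ksPredict γ v etaU s
          (D.ksPseudo γ v etaU s (D.ksFilter γ v etaU s.castSucc))).1))) := by
  obtain ⟨c₀, h₀⟩ := wsq_ksUpdate hD 0 (q := (D.augm₁ γ v etaU, D.augP₁ γ)) (posDef_augP₁ hD hγ)
  choose c hc using wsq_filter_step hD hγ v etaU
  refine ⟨wsq (D.P₁ + γ⁻¹ • 1)⁻¹ (D.d 0 + v 0 - γ⁻¹ • etaU 0 - D.m₁) + c₀ + ∑ s, c s, _,
    fun s => (posDef_information (posDef_ksPseudo hD hγ v etaU s
      (posDef_ksFilter hD hγ v etaU s.castSucc)).inv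
      (posDef_augQ hD hγ s).inv.posSemidef (D.augA γ s)).posSemidef, fun ξ hv he x => ?_⟩
  have hi := wsq_initial hD hγ v etaU x
  have hs := Finset.sum_congr (rfl : (Finset.univ : Finset (Fin n)) = _) fun s _ => hc s x
  simp only [Finset.sum_add_distrib] at hs
  have ht : wsq (D.ksFilter γ v etaU 0).2⁻¹ (x 0 - (D.ksFilter γ v etaU 0).1)
      + ∑ s : Fin n, wsq (D.ksFilter γ v etaU s.succ).2⁻¹
          (x s.succ - (D.ksFilter γ v etaU s.succ).1)
      = ∑ s : Fin n, wsq (D.ksFilter γ v etaU s.castSucc).2⁻¹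
          (x s.castSucc - (D.ksFilter γ v etaU s.castSucc).1)
        + wsq (D.ksFilter γ v etaU (Fin.last n)).2⁻¹
            (x (Fin.last n) - (D.ksFilter γ v etaU (Fin.last n)).1) := by
    rw [← Fin.sum_univ_succ (fun t => wsq (D.ksFilter γ v etaU t).2⁻¹
      (x t - (D.ksFilter γ v etaU t).1)), Fin.sum_univ_castSucc]
  rw [xCost, fit, Fin.sum_univ_succ, Fin.sum_univ_succ (fun t => l2norm _ ^ 2), hv, he]
  have h₀x := h₀ (x 0)
  rw [← ksFilter_zero] at h₀x
  simp only at h₀x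
  rw [← Finset.mul_sum] at hs
  linarith

/-- The constant of `xCost_eq_wsq` is a lower bound, attained at the smoothed means because the
backward pass solves each square for zero. -/
theorem isMinOn_xCost (ξ : Iterate n Nx Ng p) :
    IsMinOn (D.xCost γ ξ) Set.univ (fun t => (D.ksSmooth γ ξ.v ξ.etaU t).1) := by
  obtain ⟨c, W, hW, h⟩ := xCost_eq_wsq hD hγ ξ.v ξ.etaU
  intro x _
  have h1 := h ξ rfl rfl x
  have h2 := h ξ rfl rfl (fun t => (D.ksSmooth γ ξ.v ξ.etaU t).1)
  have h3 := wsq_nonneg (posDef_ksFilter hD hγ ξ.v ξ.etaU (Fin.last n)).inv.posSemidef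
    (x (Fin.last n) - (D.ksFilter γ ξ.v ξ.etaU (Fin.last n)).1)
  have h4 := Finset.sum_nonneg fun (s : Fin n) (_ : s ∈ Finset.univ) => wsq_nonneg (hW s)
    (x s.castSucc - ((D.ksPseudo γ ξ.v ξ.etaU s (D.ksFilter γ ξ.v ξ.etaU s.castSucc)).1
      + ((D.ksPseudo γ ξ.v ξ.etaU s (D.ksFilter γ ξ.v ξ.etaU s.castSucc)).2 * (D.augA γ s)ᵀ *
        (D.ksPredict γ ξ.v ξ.etaU s
          (D.ksPseudo γ ξ.v ξ.etaU s (D.ksFilter γ ξ.v ξ.etaU s.castSucc))).2⁻¹) *ᵥ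
        (x s.succ - (D.ksPredict γ ξ.v ξ.etaU s
          (D.ksPseudo γ ξ.v ξ.etaU s (D.ksFilter γ ξ.v ξ.etaU s.castSucc))).1)))
  simp only [← ksSmooth_castSucc_fst, ksSmooth_last, sub_self] at h2
  have hz : ∀ M : Matrix (Fin Nx) (Fin Nx) ℝ, wsq M 0 = 0 := fun M => by simp [wsq]
  simp only [hz, Finset.sum_const_zero] at h2
  simp only [Set.mem_ofPred_eq]
  linarith

end GroupLasso

/-! ### First-order conditions and a saddle point theorem -/

theorem nonpos_of_forall_le_mul {b c : ℝ} (h : ∀ t : ℝ, 0 < t → t ≤ 1 → b ≤ t * c) : b ≤ 0 := by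
  have h1 : Tendsto (fun t : ℝ => t * c) (𝓝[>] 0) (𝓝 (0 * c)) :=
    (tendsto_id.mul_const c).mono_left nhdsWithin_le_nhds
  rw [zero_mul] at h1
  refine ge_of_tendsto h1 ?_
  filter_upwards [Ioc_mem_nhdsGT (zero_lt_one' ℝ)] with t ht using h t ht.1 ht.2

/-- Divide by `t` and let `t → 0+`. Steps are limited to `t ≤ 1` so that the lemma also serves along
segments, where only convexity is available. -/
theorem nonneg_of_forall_nonneg_quadratic {b c : ℝ}
    (h : ∀ t : ℝ, 0 < t → t ≤ 1 → 0 ≤ t * b + t ^ 2 * c) : 0 ≤ b := by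
  have : -b ≤ 0 := nonpos_of_forall_le_mul (c := c) fun t ht ht1 => by
    have h1 := h t ht ht1
    have h2 : 0 ≤ t * (b + t * c) := h1.trans_eq (by ring)
    linarith [nonneg_of_mul_nonneg_right h2 ht]
  linarith

/-- Existence of a saddle point of `ℓ x + a x x / 2 + c η x + c₀ η`, where `a` is positive definite
and `η` varies in a compact convex set. -/
theorem exists_saddle_point {X Λ : Type*} [NormedAddCommGroup X] [NormedSpace ℝ X]
    [FiniteDimensional ℝ X] [NormedAddCommGroup Λ] [NormedSpace ℝ Λ] [FiniteDimensional ℝ Λ]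
    (a : LinearMap.BilinForm ℝ X) (ha : ∀ x y, a x y = a y x) (ha' : ∀ x, a x x = 0 → x = 0)
    (ℓ : X →ₗ[ℝ] ℝ) (c : Λ →ₗ[ℝ] X →ₗ[ℝ] ℝ) (c₀ : Λ →ₗ[ℝ] ℝ) {C : Set Λ} (hC : IsCompact C)
    (hC' : Convex ℝ C) (hC₀ : C.Nonempty) :
    ∃ η ∈ C, ∃ x, (∀ h, ℓ h + a x h + c η h = 0) ∧ ∀ η' ∈ C, c (η' - η) x + c₀ (η' - η) ≤ 0 := by
  have hinj : Function.Injective a := by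
    rw [← LinearMap.ker_eq_bot, LinearMap.ker_eq_bot']
    intro x hx
    exact ha' x (by rw [hx]; rfl)
  have hsurj : Function.Surjective a :=
    (LinearMap.injective_iff_surjective_of_finrank_eq_finrank
      (Subspace.dual_finrank_eq (K := ℝ) (V := X)).symm).1 hinj
  let e : X ≃ₗ[ℝ] (X →ₗ[ℝ] ℝ) := LinearEquiv.ofBijective a ⟨hinj, hsurj⟩
  have he : ∀ f h, a (e.symm f) h = f h := fun f h =>
    congrArg (fun g : X →ₗ[ℝ] ℝ => g h) (e.apply_symm_apply f)
  let x₀ : X := e.symm (-ℓ)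
  let y : Λ →ₗ[ℝ] X := e.symm.toLinearMap ∘ₗ (-c)
  have hx₀ : ∀ h, a x₀ h = - ℓ h := fun h => he _ h
  have hy : ∀ η h, a (y η) h = - c η h := fun η h => he _ h
  have hycont : Continuous y := y.continuous_of_finiteDimensional
  have hccont : Continuous c₀ := c₀.continuous_of_finiteDimensional
  have hacont : Continuous fun x => a x x := by
    have h2 : Continuous fun x => a.toContinuousBilinearMap x x := by fun_prop
    exact h2
  -- `x₀ + y η` is the stationary point in `x` for fixed `η`. The maximised function is the value
  -- there, the dual function: stationarity turns the terms linear in `x` into `-a x x`.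
  obtain ⟨η, hη, hmax⟩ := hC.exists_isMaxOn hC₀
    (f := fun η => c₀ η - (1 / 2) * a (x₀ + y η) (x₀ + y η))
    (Continuous.continuousOn (hccont.sub (continuous_const.mul (hacont.comp
      (continuous_const.add hycont)))))
  refine ⟨η, hη, x₀ + y η, fun h => ?_, fun η' hη' => ?_⟩
  · rw [map_add, LinearMap.add_apply, hx₀, hy]; ring
  · refine nonpos_of_forall_le_mul (c := (1 / 2) * a (y (η' - η)) (y (η' - η))) fun t ht ht1 => ?_
    have hmem : η + t • (η' - η) ∈ C := hC'.add_smul_sub_mem hη hη' ⟨ht.le, ht1⟩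
    have h1 := hmax hmem
    simp only [Set.mem_ofPred_eq] at h1
    have h2 : x₀ + y (η + t • (η' - η)) = (x₀ + y η) + t • y (η' - η) := by
      rw [map_add, map_smul, add_assoc]
    have h3 := hy (η' - η) (x₀ + y η)
    rw [h2] at h1
    generalize x₀ + y η = x at *
    generalize y (η' - η) = z at *
    simp only [map_add, map_smul, LinearMap.add_apply, LinearMap.smul_apply, smul_eq_mul] at h1
    rw [ha x z, h3] at h1
    have h4 : 0 ≤ t * (t * ((1 / 2) * a z z) - (c (η' - η) x + c₀ (η' - η))) := by
      nlinarith [h1]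
    linarith [nonneg_of_mul_nonneg_right h4 ht]

/-! ### The Euclidean norm and its subgradients -/

theorem l2norm_nonneg {m : ℕ} (z : Fin m → ℝ) : 0 ≤ l2norm z := norm_nonneg _

theorem l2norm_zero {m : ℕ} : l2norm (0 : Fin m → ℝ) = 0 := by simp [l2norm]

theorem l2norm_add_le {m : ℕ} (z w : Fin m → ℝ) : l2norm (z + w) ≤ l2norm z + l2norm w :=
  norm_add_le (WithLp.toLp 2 z) (WithLp.toLp 2 w)

theorem l2norm_smul {m : ℕ} (c : ℝ) (z : Fin m → ℝ) : l2norm (c • z) = |c| * l2norm z := by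
  simp [l2norm, norm_smul]

theorem dotProduct_le_l2norm {m : ℕ} (z w : Fin m → ℝ) : z ⬝ᵥ w ≤ l2norm z * l2norm w := by
  have := real_inner_le_norm (WithLp.toLp 2 w) (WithLp.toLp 2 z)
  rw [EuclideanSpace.inner_toLp_toLp] at this
  simpa [l2norm, mul_comm] using this

theorem continuous_l2norm {m : ℕ} : Continuous (l2norm : (Fin m → ℝ) → ℝ) :=
  continuous_norm.comp (PiLp.continuous_toLp 2 _)

theorem convexOn_l2norm {m : ℕ} : ConvexOn ℝ Set.univ (l2norm : (Fin m → ℝ) → ℝ) := by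
  refine ⟨convex_univ, fun x _ y _ a b ha hb _ => ?_⟩
  refine (l2norm_add_le _ _).trans_eq ?_
  rw [l2norm_smul, l2norm_smul, abs_of_nonneg ha, abs_of_nonneg hb]; rfl

theorem isCompact_setOf_l2norm_le {m : ℕ} (r : ℝ) : IsCompact {z : Fin m → ℝ | l2norm z ≤ r} := by
  have := (isCompact_closedBall (0 : EuclideanSpace ℝ (Fin m)) r).image (PiLp.continuous_ofLp 2 _)
  convert this using 1
  ext z
  simp only [Set.mem_ofPred_eq, Set.mem_image, mem_closedBall_zero_iff]
  exact ⟨fun h => ⟨WithLp.toLp 2 z, h, rfl⟩, by rintro ⟨w, hw, rfl⟩; exact hw⟩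

/-- Vectors `λ` of the ball of radius `μ` with `λᵀ w = μ ‖w‖` are subgradients of `μ ‖·‖₂` at
`w`. -/
theorem subgradient_l2norm {m : ℕ} {μ : ℝ} {l w : Fin m → ℝ} (hl : l2norm l ≤ μ)
    (hw : l ⬝ᵥ w = μ * l2norm w) (z : Fin m → ℝ) :
    μ * l2norm w + l ⬝ᵥ (z - w) ≤ μ * l2norm z := by
  rw [dotProduct_sub, hw]
  have := dotProduct_le_l2norm l z
  nlinarith [l2norm_nonneg z]

/-! ### Linear and quadratic parts of the problem -/

namespace GroupLasso

variable {n Nx Ny Ng : ℕ} {p : Fin Ng → ℕ} (D : GroupLasso n Nx Ny Ng p)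

/-- The linear part of `u`. -/
def uLin : (Fin (n + 1) → Fin Nx → ℝ) →ₗ[ℝ] (Fin (n + 1) → Fin Nx → ℝ) where
  toFun h t := Fin.cases (motive := fun _ => Fin Nx → ℝ) (h 0)
    (fun s => h s.succ - D.B s *ᵥ h s.castSucc) t
  map_add' h h' := by
    ext t : 1
    cases t using Fin.cases with
    | zero => rfl
    | succ s => simp only [Fin.cases_succ, Pi.add_apply, mulVec_add]; abel
  map_smul' c h := by
    ext t : 1
    cases t using Fin.cases with
    | zero => rfl
    | succ s => simp [mulVec_smul, smul_sub]

theorem u_add (x h : Fin (n + 1) → Fin Nx → ℝ) : D.u (x + h) = D.u x + D.uLin h := by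
  ext t : 1
  cases t using Fin.cases with
  | zero =>
    simp only [Pi.add_apply, u_zero, uLin, LinearMap.coe_mk, AddHom.coe_mk, Fin.cases_zero]
    abel
  | succ s =>
    simp only [Pi.add_apply, u_succ, uLin, LinearMap.coe_mk, AddHom.coe_mk, Fin.cases_succ,
      mulVec_add]
    abel

theorem u_sub (x x' : Fin (n + 1) → Fin Nx → ℝ) : D.u x - D.u x' = D.uLin (x - x') := by
  have := D.u_add x' (x - x')
  rw [add_sub_cancel] at this
  rw [this]; abel

theorem u_eq (x : Fin (n + 1) → Fin Nx → ℝ) : D.u x = D.uLin x + D.u 0 := by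
  have := D.u_add 0 x
  rw [zero_add] at this
  rw [this]
  exact add_comm _ _

/-- The Hessian of the smooth part of the objective. -/
def hess : LinearMap.BilinForm ℝ (Fin (n + 1) → Fin Nx → ℝ) :=
  LinearMap.mk₂ ℝ (fun x h => ∑ t, (D.H t *ᵥ h t) ⬝ᵥ ((D.R t)⁻¹ *ᵥ (D.H t *ᵥ x t))
    + ∑ t : Fin n, (h t.succ - D.A t *ᵥ h t.castSucc) ⬝ᵥ
        ((D.Q t)⁻¹ *ᵥ (x t.succ - D.A t *ᵥ x t.castSucc))
    + h 0 ⬝ᵥ (D.P₁⁻¹ *ᵥ x 0))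
    (fun x x' h => by
      simp only [Pi.add_apply, mulVec_add, add_sub_add_comm, dotProduct_add,
        Finset.sum_add_distrib]; ring)
    (fun c x h => by
      simp only [Pi.smul_apply, mulVec_smul, ← smul_sub, dotProduct_smul, ← Finset.smul_sum,
        ← smul_add])
    (fun x h h' => by
      simp only [Pi.add_apply, mulVec_add, add_sub_add_comm, add_dotProduct,
        Finset.sum_add_distrib]; ring)
    (fun c x h => by
      simp only [Pi.smul_apply, mulVec_smul, ← smul_sub, smul_dotProduct, ← Finset.smul_sum,
        ← smul_add])

/-- The derivative of the smooth part of the objective at `0`. -/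
def grad₀ : (Fin (n + 1) → Fin Nx → ℝ) →ₗ[ℝ] ℝ where
  toFun h := - ∑ t, (D.H t *ᵥ h t) ⬝ᵥ ((D.R t)⁻¹ *ᵥ (D.y t - D.e t))
    - ∑ t : Fin n, (h t.succ - D.A t *ᵥ h t.castSucc) ⬝ᵥ ((D.Q t)⁻¹ *ᵥ D.b t)
    - h 0 ⬝ᵥ (D.P₁⁻¹ *ᵥ D.m₁)
  map_add' h h' := by
    simp only [Pi.add_apply, mulVec_add, add_sub_add_comm, add_dotProduct,
      Finset.sum_add_distrib]; ring
  map_smul' c h := by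
    simp only [Pi.smul_apply, mulVec_smul, ← smul_sub, smul_dotProduct, ← Finset.smul_sum,
      ← smul_neg, RingHom.id_apply]

theorem hess_self (h : Fin (n + 1) → Fin Nx → ℝ) : D.hess h h = ∑ t, wsq (D.R t)⁻¹ (D.H t *ᵥ h t)
    + ∑ t : Fin n, wsq (D.Q t)⁻¹ (h t.succ - D.A t *ᵥ h t.castSucc) + wsq D.P₁⁻¹ (h 0) := rfl

variable {D} (hD : D.PosDefCov)
include hD

theorem hess_symm (x h : Fin (n + 1) → Fin Nx → ℝ) : D.hess x h = D.hess h x := by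
  simp only [hess, LinearMap.mk₂_apply]
  congr 1
  · congr 1
    · exact Finset.sum_congr rfl fun t _ =>
        dotProduct_mulVec_comm_of_isHermitian (hD.R t).isHermitian.inv _ _
    · exact Finset.sum_congr rfl fun t _ =>
        dotProduct_mulVec_comm_of_isHermitian (hD.Q t).isHermitian.inv _ _
  · exact dotProduct_mulVec_comm_of_isHermitian hD.P₁.isHermitian.inv _ _

theorem hess_nonneg (h : Fin (n + 1) → Fin Nx → ℝ) : 0 ≤ D.hess h h := by
  rw [hess_self]
  exact add_nonneg (add_nonneg
    (Finset.sum_nonneg fun t _ => wsq_nonneg (hD.R t).inv.posSemidef _)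
    (Finset.sum_nonneg fun t _ => wsq_nonneg (hD.Q t).inv.posSemidef _))
    (wsq_nonneg hD.P₁.inv.posSemidef _)

/-- The initial covariance forces the first state to vanish and the dynamics propagate this in time;
the measurement matrices may be arbitrary. -/
theorem eq_zero_of_hess_self {h : Fin (n + 1) → Fin Nx → ℝ} (h0 : D.hess h h = 0) : h = 0 := by
  rw [hess_self] at h0
  have h1 : 0 ≤ ∑ t, wsq (D.R t)⁻¹ (D.H t *ᵥ h t) :=
    Finset.sum_nonneg fun t _ => wsq_nonneg (hD.R t).inv.posSemidef _
  have h2' := fun t : Fin n =>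
    wsq_nonneg (hD.Q t).inv.posSemidef (h t.succ - D.A t *ᵥ h t.castSucc)
  have h2 := Finset.sum_nonneg fun t (_ : t ∈ Finset.univ) => h2' t
  have h3 := wsq_nonneg hD.P₁.inv.posSemidef (h 0)
  have hz : ∀ {m : ℕ} {M : Matrix (Fin m) (Fin m) ℝ}, M.PosDef → ∀ z, wsq M z = 0 → z = 0 := by
    intro m M hM z hz
    by_contra hne
    exact (hM.dotProduct_mulVec_pos hne).ne' (by simpa [wsq] using hz)
  have hs : ∑ t : Fin n, wsq (D.Q t)⁻¹ (h t.succ - D.A t *ᵥ h t.castSucc) = 0 := by linarith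
  rw [Finset.sum_eq_zero_iff_of_nonneg fun t _ => h2' t] at hs
  ext t : 1
  induction t using Fin.induction with
  | zero => exact hz hD.P₁.inv _ (by linarith)
  | succ s ih =>
    have := hz (hD.Q s).inv _ (hs s (Finset.mem_univ s))
    rw [ih] at this
    simpa using this

/-- The Taylor expansion of the smooth part of the objective. -/
theorem fit_add (x h : Fin (n + 1) → Fin Nx → ℝ) :
    D.fit (x + h) = D.fit x + (D.grad₀ h + D.hess x h) + (1 / 2) * D.hess h h := by
  have e1 : ∀ t, wsq (D.R t)⁻¹ (D.y t - (D.H t *ᵥ (x + h) t + D.e t))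
      = wsq (D.R t)⁻¹ (D.y t - (D.H t *ᵥ x t + D.e t))
        - 2 * ((D.H t *ᵥ h t) ⬝ᵥ ((D.R t)⁻¹ *ᵥ (D.y t - D.e t)))
        + 2 * ((D.H t *ᵥ h t) ⬝ᵥ ((D.R t)⁻¹ *ᵥ (D.H t *ᵥ x t)))
        + wsq (D.R t)⁻¹ (D.H t *ᵥ h t) := fun t => by
    have : D.y t - (D.H t *ᵥ (x + h) t + D.e t)
        = D.y t - (D.H t *ᵥ x t + D.e t) - D.H t *ᵥ h t := by
      rw [Pi.add_apply, mulVec_add]; abel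
    rw [this, wsq_sub (hD.R t).isHermitian.inv]
    simp only [mulVec_sub, mulVec_add, dotProduct_sub, dotProduct_add]; ring
  have e2 : ∀ t : Fin n, wsq (D.Q t)⁻¹ ((x + h) t.succ - (D.A t *ᵥ (x + h) t.castSucc + D.b t))
      = wsq (D.Q t)⁻¹ (x t.succ - (D.A t *ᵥ x t.castSucc + D.b t))
        - 2 * ((h t.succ - D.A t *ᵥ h t.castSucc) ⬝ᵥ ((D.Q t)⁻¹ *ᵥ D.b t))
        + 2 * ((h t.succ - D.A t *ᵥ h t.castSucc) ⬝ᵥ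
            ((D.Q t)⁻¹ *ᵥ (x t.succ - D.A t *ᵥ x t.castSucc)))
        + wsq (D.Q t)⁻¹ (h t.succ - D.A t *ᵥ h t.castSucc) := fun t => by
    have : (x + h) t.succ - (D.A t *ᵥ (x + h) t.castSucc + D.b t)
        = x t.succ - (D.A t *ᵥ x t.castSucc + D.b t) + (h t.succ - D.A t *ᵥ h t.castSucc) := by
      rw [Pi.add_apply, Pi.add_apply, mulVec_add]; abel
    rw [this, wsq_add (hD.Q t).isHermitian.inv, ← sub_sub, mulVec_sub _ _ (D.b t), dotProduct_sub]
    ring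
  have e3 : wsq D.P₁⁻¹ ((x + h) 0 - D.m₁) = wsq D.P₁⁻¹ (x 0 - D.m₁)
      - 2 * (h 0 ⬝ᵥ (D.P₁⁻¹ *ᵥ D.m₁)) + 2 * (h 0 ⬝ᵥ (D.P₁⁻¹ *ᵥ x 0)) + wsq D.P₁⁻¹ (h 0) := by
    have : (x + h) 0 - D.m₁ = x 0 - D.m₁ + h 0 := by rw [Pi.add_apply]; abel
    rw [this, wsq_add hD.P₁.isHermitian.inv, mulVec_sub, dotProduct_sub]; ring
  rw [hess_self]
  simp only [fit, e1, e2, e3, hess, LinearMap.mk₂_apply, grad₀, LinearMap.coe_mk, AddHom.coe_mk,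
    Finset.sum_add_distrib, Finset.sum_sub_distrib, ← Finset.mul_sum]
  ring

theorem fit_ge (x x' : Fin (n + 1) → Fin Nx → ℝ) :
    D.fit x + (D.grad₀ (x' - x) + D.hess x (x' - x)) ≤ D.fit x' := by
  have := fit_add hD x (x' - x)
  rw [add_sub_cancel] at this
  linarith [hess_nonneg hD (x' - x)]

omit hD in
/-- The derivative of a function whose Taylor expansion at `x` has no linear term. -/
theorem hasFDerivAt_zero_of_hess {f : (Fin (n + 1) → Fin Nx → ℝ) → ℝ}
    {x : Fin (n + 1) → Fin Nx → ℝ} (hf : ∀ h, f (x + h) = f x + (1 / 2) * D.hess h h) :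
    HasFDerivAt f (0 : (Fin (n + 1) → Fin Nx → ℝ) →L[ℝ] ℝ) x := by
  let a := D.hess.toContinuousBilinearMap
  have h1 : HasFDerivAt (fun z => f x + (1 / 2) * a (z - x) (z - x))
      (0 : (Fin (n + 1) → Fin Nx → ℝ) →L[ℝ] ℝ) x := by
    have hs : HasFDerivAt (fun z => z - x) (ContinuousLinearMap.id ℝ _) x :=
      (hasFDerivAt_id x).sub_const x
    have h2 := a.isBoundedBilinearMap.hasFDerivAt (x - x, x - x)
    have h3 := h2.comp x (hs.prodMk hs)
    have h4 := (h3.const_mul (1 / 2)).const_add (f x)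
    refine h4.congr_fderiv ?_
    ext z
    simp
  refine h1.congr_of_eventuallyEq (Eventually.of_forall fun z => ?_)
  have := hf (z - x)
  rw [add_sub_cancel] at this
  exact this

end GroupLasso

/-! ### The split constraint space and its inner product -/

theorem l2norm_add_sq {m : ℕ} (z w : Fin m → ℝ) :
    l2norm (z + w) ^ 2 = l2norm z ^ 2 + 2 * (w ⬝ᵥ z) + l2norm w ^ 2 := by
  simp only [l2norm_sq, dotProduct_add, add_dotProduct, dotProduct_comm z w]; ring

/-- The space of the constraints `(u_t - v_t, w_{g,t} - G_{g,t} v_t)` and their multipliers. -/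
abbrev SplitSpace (n Nx : ℕ) {Ng : ℕ} (p : Fin Ng → ℕ) : Type :=
  (Fin (n + 1) → Fin Nx → ℝ) × (Fin (n + 1) → (g : Fin Ng) → Fin (p g) → ℝ)

namespace SplitSpace

variable {n Nx Ng : ℕ} {p : Fin Ng → ℕ}

/-- The Euclidean inner product. -/
def pairing : LinearMap.BilinForm ℝ (SplitSpace n Nx p) :=
  LinearMap.mk₂ ℝ (fun a b => ∑ t, a.1 t ⬝ᵥ b.1 t + ∑ t, ∑ g, a.2 t g ⬝ᵥ b.2 t g)
    (fun a a' b => by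
      simp only [Prod.fst_add, Prod.snd_add, Pi.add_apply, add_dotProduct,
        Finset.sum_add_distrib]; ring)
    (fun c a b => by
      simp only [Prod.smul_fst, Prod.smul_snd, Pi.smul_apply, smul_dotProduct, ← Finset.smul_sum,
        ← smul_add])
    (fun a b b' => by
      simp only [Prod.fst_add, Prod.snd_add, Pi.add_apply, dotProduct_add,
        Finset.sum_add_distrib]; ring)
    (fun c a b => by
      simp only [Prod.smul_fst, Prod.smul_snd, Pi.smul_apply, dotProduct_smul, ← Finset.smul_sum,
        ← smul_add])

theorem pairing_apply (a b : SplitSpace n Nx p) :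
    pairing a b = ∑ t, a.1 t ⬝ᵥ b.1 t + ∑ t, ∑ g, a.2 t g ⬝ᵥ b.2 t g := rfl

theorem pairing_comm (a b : SplitSpace n Nx p) : pairing a b = pairing b a := by
  simp only [pairing_apply, dotProduct_comm]

theorem pairing_self (a : SplitSpace n Nx p) :
    pairing a a = ∑ t, l2norm (a.1 t) ^ 2 + ∑ t, ∑ g, l2norm (a.2 t g) ^ 2 := by
  simp only [pairing_apply, l2norm_sq]

theorem pairing_self_nonneg (a : SplitSpace n Nx p) : 0 ≤ pairing a a := by
  rw [pairing_self]; positivity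

end SplitSpace

open SplitSpace

/-- The multipliers of a point. -/
def Iterate.dual {n Nx Ng : ℕ} {p : Fin Ng → ℕ} (ξ : Iterate n Nx Ng p) : SplitSpace n Nx p :=
  (ξ.etaU, ξ.etaW)

/-! ### Optimality conditions and existence of a KKT point -/

namespace GroupLasso

variable {n Nx Ny Ng : ℕ} {p : Fin Ng → ℕ} (D : GroupLasso n Nx Ny Ng p)

/-- The linear map `v ↦ (v_t, G_{g,t} v_t)`. -/
def split : (Fin (n + 1) → Fin Nx → ℝ) →ₗ[ℝ] SplitSpace n Nx p where
  toFun v := (v, fun t g => D.G g t *ᵥ v t)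
  map_add' v v' := by
    refine Prod.ext rfl ?_
    funext t g
    simp [mulVec_add]
  map_smul' c v := by
    refine Prod.ext rfl ?_
    funext t g
    simp [mulVec_smul]

theorem split_fst (v : Fin (n + 1) → Fin Nx → ℝ) : (D.split v).1 = v := rfl

theorem split_snd (v : Fin (n + 1) → Fin Nx → ℝ) (t : Fin (n + 1)) (g : Fin Ng) :
    (D.split v).2 t g = D.G g t *ᵥ v t := rfl

theorem pairing_split (v : Fin (n + 1) → Fin Nx → ℝ) (y : SplitSpace n Nx p) :
    pairing (D.split v) y = ∑ t, v t ⬝ᵥ (y.1 t + ∑ g, (D.G g t)ᵀ *ᵥ y.2 t g) := by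
  rw [pairing_apply, ← Finset.sum_add_distrib]
  refine Finset.sum_congr rfl fun t _ => ?_
  rw [dotProduct_add, dotProduct_sum]
  congr 1
  refine Finset.sum_congr rfl fun g _ => ?_
  rw [split_snd, dotProduct_mulVec, vecMul_transpose]

theorem adjoint_eq_zero {y : SplitSpace n Nx p} (h : ∀ v, pairing (D.split v) y = 0)
    (t : Fin (n + 1)) : y.1 t + ∑ g, (D.G g t)ᵀ *ᵥ y.2 t g = 0 := by
  have h1 := h (fun t => y.1 t + ∑ g, (D.G g t)ᵀ *ᵥ y.2 t g)
  rw [pairing_split, Finset.sum_eq_zero_iff_of_nonneg fun t _ => by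
    rw [← l2norm_sq]; positivity] at h1
  have := h1 t (Finset.mem_univ t)
  rwa [dotProduct_self_eq_zero] at this

/-- `(x, w)` minimises the split objective plus the linear function `y`. -/
structure IsCritical (x : Fin (n + 1) → Fin Nx → ℝ)
    (w : Fin (n + 1) → (g : Fin Ng) → Fin (p g) → ℝ) (y : SplitSpace n Nx p) : Prop where
  grad : ∀ h, D.grad₀ h + D.hess x h + pairing (D.uLin h, 0) y = 0
  sub : ∀ t g (z : Fin (p g) → ℝ),
    D.μ * l2norm (w t g) + (-y.2 t g) ⬝ᵥ (z - w t g) ≤ D.μ * l2norm z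

/-- The optimality conditions that the result `ξ'` of an ADMM iteration from `ξ` satisfies. -/
structure IsADMMStep (γ : ℝ) (ξ ξ' : Iterate n Nx Ng p) : Prop where
  crit : D.IsCritical ξ'.x ξ'.w (ξ'.dual + γ • D.split (ξ'.v - ξ.v))
  adj : ∀ v, pairing (D.split v) ξ'.dual = 0
  dual : ξ'.dual = ξ.dual + γ • ((D.u ξ'.x, ξ'.w) - D.split ξ'.v)

/-- The Karush–Kuhn–Tucker conditions of the split problem. -/
structure IsKKT (ξ : Iterate n Nx Ng p) : Prop where
  crit : D.IsCritical ξ.x ξ.w ξ.dual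
  adj : ∀ v, pairing (D.split v) ξ.dual = 0
  feas : (D.u ξ.x, ξ.w) = D.split ξ.v

variable {D}

/-- KKT points are fixed points of the iteration, so two-step estimates specialise to distances from
a KKT point. -/
theorem IsKKT.isADMMStep {ξ : Iterate n Nx Ng p} (h : D.IsKKT ξ) (γ : ℝ) :
    D.IsADMMStep γ ξ ξ where
  crit := by simpa using h.crit
  adj := h.adj
  dual := by simp [h.feas]

theorem IsKKT.u_eq {ξ : Iterate n Nx Ng p} (h : D.IsKKT ξ) : D.u ξ.x = ξ.v :=
  congrArg Prod.fst h.feas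

theorem IsKKT.w_eq {ξ : Iterate n Nx Ng p} (h : D.IsKKT ξ) (t : Fin (n + 1)) (g : Fin Ng) :
    ξ.w t g = D.G g t *ᵥ ξ.v t :=
  congrFun (congrFun (congrArg Prod.snd h.feas) t) g

/-- Add the tangent inequality of the convex smooth part to the subgradient inequalities of the
groups. All uses of convexity in the ADMM estimates go through this bound. -/
theorem IsCritical.obj_le (hD : D.PosDefCov) {ξ : Iterate n Nx Ng p} {y : SplitSpace n Nx p}
    (h : D.IsCritical ξ.x ξ.w y) (ξ' : Iterate n Nx Ng p) :
    D.splitObj ξ - pairing (D.uLin (ξ'.x - ξ.x), ξ'.w - ξ.w) y ≤ D.splitObj ξ' := by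
  have h1 := fit_ge hD ξ.x ξ'.x
  have h2 := h.grad (ξ'.x - ξ.x)
  have h3 : ∑ t, ∑ g, (D.μ * l2norm (ξ.w t g) + (-y.2 t g) ⬝ᵥ (ξ'.w t g - ξ.w t g))
      ≤ ∑ t, ∑ g, D.μ * l2norm (ξ'.w t g) :=
    Finset.sum_le_sum fun t _ => Finset.sum_le_sum fun g _ => h.sub t g _
  simp only [pairing_apply, splitObj] at h2 ⊢
  simp only [Pi.zero_apply, zero_dotProduct, Finset.sum_const_zero] at h2
  simp only [Finset.sum_add_distrib, neg_dotProduct, Finset.sum_neg_distrib] at h3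
  simp only [Pi.sub_apply, dotProduct_comm (_ - _) (y.2 _ _)]
  linarith

theorem IsKKT.isStationary (hD : D.PosDefCov) {ξ : Iterate n Nx Ng p} (h : D.IsKKT ξ) :
    D.IsStationary ξ where
  feas_u t := congrFun h.u_eq t
  feas_w := h.w_eq
  stat_x := hasFDerivAt_zero_of_hess fun z => by
    have h1 := h.crit.grad z
    simp only [pairing_apply, Pi.zero_apply, zero_dotProduct, Finset.sum_const_zero,
      Iterate.dual] at h1
    simp only [fit_add hD, u_add, Pi.add_apply, dotProduct_add, Finset.sum_add_distrib,
      dotProduct_comm (ξ.etaU _) (D.uLin _ _)]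
    linear_combination h1
  stat_w := h.crit.sub
  stat_v := D.adjoint_eq_zero h.adj

theorem IsKKT.isMinOn_objective (hD : D.PosDefCov) {ξ : Iterate n Nx Ng p} (h : D.IsKKT ξ) :
    IsMinOn D.objective Set.univ ξ.x := by
  intro x _
  -- Compare with the feasible lift of `x`: the displacement lies in the range of `D.split`, where
  -- the multiplier vanishes. The zeros are irrelevant, since `splitObj` reads only `x` and `w`.
  have h1 := h.crit.obj_le hD ⟨x, (D.split (D.u x)).2, 0, 0, 0⟩
  have e : (D.uLin (x - ξ.x), (D.split (D.u x)).2 - ξ.w) = D.split (D.uLin (x - ξ.x)) := by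
    refine Prod.ext rfl ?_
    funext t g
    rw [split_snd, ← u_sub, h.u_eq]
    simp [split_snd, h.w_eq, mulVec_sub]
  simp only [e, h.adj, splitObj, split_snd, h.w_eq, ← h.u_eq] at h1
  simpa [objective] using h1

theorem exists_isKKT (hD : D.PosDefCov) (hμ : 0 < D.μ) : ∃ ξ, D.IsKKT ξ := by
  let C : Set (Fin (n + 1) → (g : Fin Ng) → Fin (p g) → ℝ) :=
    Set.pi Set.univ fun _ => Set.pi Set.univ fun _ => {z | l2norm z ≤ D.μ}
  have hC : IsCompact C := isCompact_univ_pi fun _ => isCompact_univ_pi fun _ =>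
    isCompact_setOf_l2norm_le _
  have hC' : Convex ℝ C := convex_pi fun _ _ => convex_pi fun _ _ => by
    simpa using convexOn_l2norm.convex_le D.μ
  have hC₀ : C.Nonempty := ⟨0, fun _ _ _ _ => by simpa [l2norm_zero] using hμ.le⟩
  let f : (Fin (n + 1) → (g : Fin Ng) → Fin (p g) → ℝ) →ₗ[ℝ] SplitSpace n Nx p →ₗ[ℝ] ℝ :=
    LinearMap.comp (LinearMap.flip pairing) (LinearMap.inr ℝ _ _)
  -- With `w` and `v` eliminated, `μ ‖·‖₂` is the support function of the ball of radius `μ`. The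
  -- saddle variable `l` will be `-etaW`, and `etaU` is then forced by `stat_v`.
  obtain ⟨l, hl, x, hx, hmax⟩ := exists_saddle_point D.hess (hess_symm hD)
    (fun x => eq_zero_of_hess_self hD) D.grad₀ (f.compl₂ (D.split ∘ₗ D.uLin))
    (f.flip (D.split (D.u 0))) hC hC' hC₀
  have hf : ∀ l y, f l y = ∑ t, ∑ g, y.2 t g ⬝ᵥ l t g := fun l y => by
    simp [f, pairing_apply]
  have hlb : ∀ t g, l2norm (l t g) ≤ D.μ := fun t g => hl t trivial g trivial
  let w : Fin (n + 1) → (g : Fin Ng) → Fin (p g) → ℝ := (D.split (D.u x)).2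
  have hmax' : ∀ l' ∈ C, ∑ t, ∑ g, w t g ⬝ᵥ (l' t g - l t g) ≤ 0 := fun l' hl' => by
    have := hmax l' hl'
    simp only [LinearMap.compl₂_apply, LinearMap.flip_apply, LinearMap.comp_apply] at this
    rw [← map_add, ← map_add, ← u_eq, hf] at this
    exact this
  have hlw : ∀ t g, l t g ⬝ᵥ w t g = D.μ * l2norm (w t g) := by
    have hle : ∀ t g, l t g ⬝ᵥ w t g ≤ D.μ * l2norm (w t g) := fun t g =>
      (dotProduct_le_l2norm _ _).trans
        (mul_le_mul_of_nonneg_right (hlb t g) (l2norm_nonneg _))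
    -- Test multiplier `μ w / ‖w‖`, equal to `0` where `w = 0` because `0⁻¹ = 0`. Each summand is
    -- nonnegative by Cauchy–Schwarz and the total is nonpositive, so all vanish.
    let l' : Fin (n + 1) → (g : Fin Ng) → Fin (p g) → ℝ := fun t g =>
      (D.μ * (l2norm (w t g))⁻¹) • w t g
    have hl' : l' ∈ C := fun t _ g _ => by
      simp only [Set.mem_ofPred_eq, l']
      rw [l2norm_smul, abs_of_nonneg (mul_nonneg hμ.le (inv_nonneg.2 (l2norm_nonneg _))), mul_assoc]
      exact mul_le_of_le_one_right hμ.le inv_mul_le_one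
    have h0 := hmax' l' hl'
    have e : ∀ t g, w t g ⬝ᵥ (l' t g - l t g) = D.μ * l2norm (w t g) - l t g ⬝ᵥ w t g := by
      intro t g
      simp only [l', dotProduct_sub, dotProduct_smul, ← l2norm_sq, smul_eq_mul,
        dotProduct_comm (l t g)]
      by_cases hz : l2norm (w t g) = 0
      · simp [hz]
      · field_simp
    simp only [e] at h0
    have hnn : ∀ t g, 0 ≤ D.μ * l2norm (w t g) - l t g ⬝ᵥ w t g := fun t g =>
      sub_nonneg.2 (hle t g)
    have h1 := le_antisymm h0 (Finset.sum_nonneg fun t _ => Finset.sum_nonneg fun g _ => hnn t g)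
    rw [Finset.sum_eq_zero_iff_of_nonneg fun t _ => Finset.sum_nonneg fun g _ => hnn t g] at h1
    intro t g
    have h2 := h1 t (Finset.mem_univ t)
    rw [Finset.sum_eq_zero_iff_of_nonneg fun g _ => hnn t g] at h2
    linarith [h2 g (Finset.mem_univ g)]
  have hadj : ∀ v, pairing (D.split v) (fun t => ∑ g, (D.G g t)ᵀ *ᵥ l t g, -l) = 0 := fun v => by
    rw [pairing_split]
    simp [mulVec_neg]
  refine ⟨⟨x, w, D.u x, fun t => ∑ g, (D.G g t)ᵀ *ᵥ l t g, -l⟩, ⟨fun h => ?_, fun t g z => ?_⟩,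
    hadj, rfl⟩
  · have h1 := hx h
    have h2 := hadj (D.uLin h)
    simp only [LinearMap.compl₂_apply, LinearMap.comp_apply, hf] at h1
    simp only [pairing_apply, Pi.neg_apply, dotProduct_neg, Finset.sum_neg_distrib, Iterate.dual,
      Pi.zero_apply, zero_dotProduct, Finset.sum_const_zero, split_fst, neg_zero, add_zero]
      at h2 ⊢
    linarith
  · simpa [Iterate.dual] using subgradient_l2norm (hlb t g) (hlw t g) z

theorem xCost_add_smul (hD : D.PosDefCov) (γ : ℝ) (ξ : Iterate n Nx Ng p)
    (x h : Fin (n + 1) → Fin Nx → ℝ) (s : ℝ) :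
    D.xCost γ ξ (x + s • h) = D.xCost γ ξ x + (s * (D.grad₀ h + D.hess x h
        + γ * ∑ t, D.uLin h t ⬝ᵥ (D.u x t - ξ.v t + γ⁻¹ • ξ.etaU t))
      + s ^ 2 * ((1 / 2) * D.hess h h + γ / 2 * ∑ t, l2norm (D.uLin h t) ^ 2)) := by
  have e : ∀ t, l2norm (D.u (x + s • h) t - ξ.v t + γ⁻¹ • ξ.etaU t) ^ 2
      = l2norm (D.u x t - ξ.v t + γ⁻¹ • ξ.etaU t) ^ 2
        + 2 * s * (D.uLin h t ⬝ᵥ (D.u x t - ξ.v t + γ⁻¹ • ξ.etaU t))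
        + s ^ 2 * l2norm (D.uLin h t) ^ 2 := fun t => by
    have : D.u (x + s • h) t - ξ.v t + γ⁻¹ • ξ.etaU t
        = (D.u x t - ξ.v t + γ⁻¹ • ξ.etaU t) + s • D.uLin h t := by
      rw [u_add, map_smul, Pi.add_apply, Pi.smul_apply]; abel
    rw [this, l2norm_add_sq, l2norm_smul, mul_pow, sq_abs, smul_dotProduct, smul_eq_mul]; ring
  simp only [xCost, fit_add hD, e, Finset.sum_add_distrib, ← Finset.mul_sum, map_smul,
    LinearMap.smul_apply, smul_eq_mul]
  ring

theorem vCost_add_smul (γ : ℝ) (ξ ξ' : Iterate n Nx Ng p) (t : Fin (n + 1)) (v h : Fin Nx → ℝ)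
    (s : ℝ) :
    D.vCost γ ξ ξ' t (v + s • h) = D.vCost γ ξ ξ' t v + (s * (-γ * (h ⬝ᵥ (D.u ξ'.x t - v
          + γ⁻¹ • ξ.etaU t) + ∑ g, (D.G g t *ᵥ h) ⬝ᵥ (ξ'.w t g - D.G g t *ᵥ v + γ⁻¹ • ξ.etaW t g)))
      + s ^ 2 * (γ / 2 * (l2norm h ^ 2 + ∑ g, l2norm (D.G g t *ᵥ h) ^ 2))) := by
  have e1 : l2norm (D.u ξ'.x t - (v + s • h) + γ⁻¹ • ξ.etaU t) ^ 2
      = l2norm (D.u ξ'.x t - v + γ⁻¹ • ξ.etaU t) ^ 2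
        - 2 * s * (h ⬝ᵥ (D.u ξ'.x t - v + γ⁻¹ • ξ.etaU t)) + s ^ 2 * l2norm h ^ 2 := by
    have : D.u ξ'.x t - (v + s • h) + γ⁻¹ • ξ.etaU t
        = (D.u ξ'.x t - v + γ⁻¹ • ξ.etaU t) + (-s) • h := by
      rw [neg_smul]; abel
    rw [this, l2norm_add_sq, l2norm_smul, mul_pow, sq_abs, smul_dotProduct, smul_eq_mul]; ring
  have e2 : ∀ g, l2norm (ξ'.w t g - D.G g t *ᵥ (v + s • h) + γ⁻¹ • ξ.etaW t g) ^ 2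
      = l2norm (ξ'.w t g - D.G g t *ᵥ v + γ⁻¹ • ξ.etaW t g) ^ 2
        - 2 * s * ((D.G g t *ᵥ h) ⬝ᵥ (ξ'.w t g - D.G g t *ᵥ v + γ⁻¹ • ξ.etaW t g))
        + s ^ 2 * l2norm (D.G g t *ᵥ h) ^ 2 := fun g => by
    have : ξ'.w t g - D.G g t *ᵥ (v + s • h) + γ⁻¹ • ξ.etaW t g
        = (ξ'.w t g - D.G g t *ᵥ v + γ⁻¹ • ξ.etaW t g) + (-s) • (D.G g t *ᵥ h) := by
      rw [neg_smul, mulVec_add, mulVec_smul]; abel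
    rw [this, l2norm_add_sq, l2norm_smul, mul_pow, sq_abs, smul_dotProduct, smul_eq_mul]; ring
  simp only [vCost, e1, e2, Finset.sum_add_distrib, Finset.sum_sub_distrib, ← Finset.mul_sum]
  ring

/-- The norm is not differentiable, so the expansion is one-sided: convexity bounds the norm along
the segment, and the penalty expands exactly. -/
theorem wCost_update_le (hμ : 0 < D.μ) (γ : ℝ) (ξ : Iterate n Nx Ng p) (t : Fin (n + 1))
    (w z : (g : Fin Ng) → Fin (p g) → ℝ) (s : ℝ) (hs : 0 ≤ s) (hs1 : s ≤ 1) :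
    D.wCost γ ξ t (w + s • (z - w)) ≤ D.wCost γ ξ t w + (s * (∑ g, (D.μ * l2norm (z g)
          - D.μ * l2norm (w g)
          + (z g - w g) ⬝ᵥ (γ • (w g - D.G g t *ᵥ ξ.v t + γ⁻¹ • ξ.etaW t g))))
      + s ^ 2 * (γ / 2 * ∑ g, l2norm (z g - w g) ^ 2)) := by
  have e1 : ∀ g, D.μ * l2norm ((w + s • (z - w)) g)
      ≤ D.μ * l2norm (w g) + s * (D.μ * l2norm (z g) - D.μ * l2norm (w g)) := fun g => by
    have h1 := convexOn_l2norm.2 (Set.mem_univ (w g)) (Set.mem_univ (z g)) (sub_nonneg.2 hs1) hs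
      (by ring)
    have h2 : (w + s • (z - w)) g = (1 - s) • w g + s • z g := by
      rw [Pi.add_apply, Pi.smul_apply, Pi.sub_apply, smul_sub, sub_smul, one_smul]; abel
    rw [h2]
    simp only [smul_eq_mul] at h1
    have := mul_le_mul_of_nonneg_left h1 hμ.le
    linarith
  have e2 : ∀ g, l2norm ((w + s • (z - w)) g - D.G g t *ᵥ ξ.v t + γ⁻¹ • ξ.etaW t g) ^ 2
      = l2norm (w g - D.G g t *ᵥ ξ.v t + γ⁻¹ • ξ.etaW t g) ^ 2
        + 2 * s * ((z g - w g) ⬝ᵥ (w g - D.G g t *ᵥ ξ.v t + γ⁻¹ • ξ.etaW t g))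
        + s ^ 2 * l2norm (z g - w g) ^ 2 := fun g => by
    have : (w + s • (z - w)) g - D.G g t *ᵥ ξ.v t + γ⁻¹ • ξ.etaW t g
        = (w g - D.G g t *ᵥ ξ.v t + γ⁻¹ • ξ.etaW t g) + s • (z g - w g) := by
      rw [Pi.add_apply, Pi.smul_apply, Pi.sub_apply]; abel
    rw [this, l2norm_add_sq, l2norm_smul, mul_pow, sq_abs, smul_dotProduct, smul_eq_mul]; ring
  have h3 := Finset.sum_le_sum fun g (_ : g ∈ Finset.univ) => e1 g
  simp only [wCost, e2, Finset.sum_add_distrib, ← Finset.mul_sum, dotProduct_smul, smul_eq_mul]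
    at h3 ⊢
  linarith

/-- The subproblems for `x` and `w` see the old `v`. Rewriting their multiplier through the dual
update yields the new multiplier plus `γ S (v' - v)`; the `v`-subproblem sees the new multiplier
without any shift. -/
theorem KSmADMMStep.isADMMStep (hD : D.PosDefCov) (hμ : 0 < D.μ) {γ : ℝ} (hγ : 0 < γ)
    {ξ ξ' : Iterate n Nx Ng p} (h : D.KSmADMMStep γ ξ ξ') : D.IsADMMStep γ ξ ξ' := by
  have hU : ∀ t, ξ'.etaU t + γ • (ξ'.v t - ξ.v t) = γ • (D.u ξ'.x t - ξ.v t + γ⁻¹ • ξ.etaU t) :=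
    fun t => by
      rw [h.etaU_update, smul_add γ, smul_smul, mul_inv_cancel₀ hγ.ne', one_smul, add_assoc,
        ← smul_add, add_comm, sub_add_sub_cancel]
  have hW : ∀ t g, ξ'.etaW t g + γ • (D.G g t *ᵥ (ξ'.v t - ξ.v t))
      = γ • (ξ'.w t g - D.G g t *ᵥ ξ.v t + γ⁻¹ • ξ.etaW t g) := fun t g => by
    rw [h.etaW_update, smul_add γ, smul_smul, mul_inv_cancel₀ hγ.ne', one_smul, add_assoc,
      ← smul_add, add_comm, mulVec_sub, sub_add_sub_cancel]
  refine ⟨⟨?_, ?_⟩, ?_, ?_⟩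
  · have hge : ∀ z, 0 ≤ D.grad₀ z + D.hess ξ'.x z
        + γ * ∑ t, D.uLin z t ⬝ᵥ (D.u ξ'.x t - ξ.v t + γ⁻¹ • ξ.etaU t) := fun z => by
      refine nonneg_of_forall_nonneg_quadratic
        (c := (1 / 2) * D.hess z z + γ / 2 * ∑ t, l2norm (D.uLin z t) ^ 2) fun s _ _ => ?_
      have h1 := isMinOn_xCost hD hγ ξ (Set.mem_univ (ξ'.x + s • z))
      rw [← show ξ'.x = _ from funext h.x_update] at h1
      simp only [Set.mem_ofPred_eq, xCost_add_smul hD] at h1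
      linarith
    intro z
    have h1 := hge z
    have h2 := hge (-z)
    simp only [map_neg, Pi.neg_apply, neg_dotProduct, Finset.sum_neg_distrib] at h2
    have e : pairing (D.uLin z, 0) (ξ'.dual + γ • D.split (ξ'.v - ξ.v))
        = γ * ∑ t, D.uLin z t ⬝ᵥ (D.u ξ'.x t - ξ.v t + γ⁻¹ • ξ.etaU t) := by
      simp only [pairing_apply, Pi.zero_apply, zero_dotProduct, Finset.sum_const_zero, add_zero,
        Finset.mul_sum]
      refine Finset.sum_congr rfl fun t _ => ?_
      rw [← smul_eq_mul, ← dotProduct_smul, ← hU]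
      rfl
    rw [e]
    linarith
  · intro t g z
    -- Changing one group at a time extracts the subgradient inequality of that group from the joint
    -- minimality over all groups.
    have hge : 0 ≤ ∑ g', (D.μ * l2norm (Function.update (ξ'.w t) g z g')
        - D.μ * l2norm (ξ'.w t g') + (Function.update (ξ'.w t) g z g' - ξ'.w t g') ⬝ᵥ
          (γ • (ξ'.w t g' - D.G g' t *ᵥ ξ.v t + γ⁻¹ • ξ.etaW t g'))) := by
      refine nonneg_of_forall_nonneg_quadratic
        (c := γ / 2 * ∑ g', l2norm (Function.update (ξ'.w t) g z g' - ξ'.w t g') ^ 2)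
        fun s hs hs1 => ?_
      have h1 := h.w_update t (Set.mem_univ (ξ'.w t + s • (Function.update (ξ'.w t) g z - ξ'.w t)))
      simp only [Set.mem_ofPred_eq] at h1
      have h2 := wCost_update_le hμ γ ξ t (ξ'.w t) (Function.update (ξ'.w t) g z) s hs.le hs1
      linarith
    rw [Finset.sum_eq_single g (fun g' _ hne => by simp [Function.update_of_ne hne])
      (fun hn => absurd (Finset.mem_univ g) hn), Function.update_self, ← hW] at hge
    have e : (ξ'.dual + γ • D.split (ξ'.v - ξ.v)).2 t g
        = ξ'.etaW t g + γ • (D.G g t *ᵥ (ξ'.v t - ξ.v t)) := rfl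
    rw [e, neg_dotProduct, dotProduct_comm]
    linarith
  · intro z
    rw [pairing_split]
    refine Finset.sum_eq_zero fun t _ => ?_
    have hge : ∀ z : Fin Nx → ℝ, 0 ≤ -γ * (z ⬝ᵥ (D.u ξ'.x t - ξ'.v t + γ⁻¹ • ξ.etaU t)
        + ∑ g, (D.G g t *ᵥ z) ⬝ᵥ (ξ'.w t g - D.G g t *ᵥ ξ'.v t + γ⁻¹ • ξ.etaW t g)) := fun z => by
      refine nonneg_of_forall_nonneg_quadratic
        (c := γ / 2 * (l2norm z ^ 2 + ∑ g, l2norm (D.G g t *ᵥ z) ^ 2)) fun s _ _ => ?_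
      have h1 := h.v_update t (Set.mem_univ (ξ'.v t + s • z))
      simp only [Set.mem_ofPred_eq, vCost_add_smul] at h1
      linarith
    have h1 := hge (z t)
    have h2 := hge (-(z t))
    simp only [mulVec_neg, neg_dotProduct, Finset.sum_neg_distrib] at h2
    have eU : ξ'.etaU t = γ • (D.u ξ'.x t - ξ'.v t + γ⁻¹ • ξ.etaU t) := by
      rw [h.etaU_update, smul_add γ, smul_smul, mul_inv_cancel₀ hγ.ne', one_smul, add_comm]
    have eW : ∀ g, ξ'.etaW t g = γ • (ξ'.w t g - D.G g t *ᵥ ξ'.v t + γ⁻¹ • ξ.etaW t g) :=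
      fun g => by
        rw [h.etaW_update, smul_add γ, smul_smul, mul_inv_cancel₀ hγ.ne', one_smul, add_comm]
    have e : z t ⬝ᵥ (ξ'.dual.1 t + ∑ g, (D.G g t)ᵀ *ᵥ ξ'.dual.2 t g)
        = γ * (z t ⬝ᵥ (D.u ξ'.x t - ξ'.v t + γ⁻¹ • ξ.etaU t)
        + ∑ g, (D.G g t *ᵥ z t) ⬝ᵥ (ξ'.w t g - D.G g t *ᵥ ξ'.v t + γ⁻¹ • ξ.etaW t g)) := by
      simp only [Iterate.dual]
      rw [dotProduct_add, dotProduct_sum, mul_add, Finset.mul_sum, eU, dotProduct_smul, smul_eq_mul]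
      congr 1
      refine Finset.sum_congr rfl fun g _ => ?_
      rw [eW, dotProduct_mulVec, vecMul_transpose, dotProduct_smul, smul_eq_mul]
    rw [e]
    linarith
  · refine Prod.ext (funext fun t => h.etaU_update t) ?_
    funext t g
    exact h.etaW_update t g

end GroupLasso

/-! ### Rates for antitone sequences and norm comparisons -/

/-- A nonincreasing sequence that is dominated by the decrements of a nonnegative sequence. -/
theorem mul_le_of_antitone {d e : ℕ → ℝ} (hd : Antitone d)
    (h : ∀ k, 1 ≤ k → d k ≤ e k - e (k + 1)) {j : ℕ} (hj : 1 ≤ j) (N : ℕ) :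
    ((N : ℝ) + 1) * d (j + N) ≤ e j - e (j + N + 1) := by
  induction N with
  | zero => simpa using h j hj
  | succ N ih =>
    have h1 := h (j + (N + 1)) (by omega)
    have h2 : ((N : ℝ) + 1) * d (j + (N + 1)) ≤ ((N : ℝ) + 1) * d (j + N) :=
      mul_le_mul_of_nonneg_left (hd (by omega)) (by positivity)
    rw [← add_assoc j N 1] at *
    push_cast
    linarith

theorem isLittleO_of_antitone {d e : ℕ → ℝ} (hd : Antitone d) (hd0 : ∀ k, 0 ≤ d k)
    (h : ∀ k, 1 ≤ k → d k ≤ e k - e (k + 1)) (he0 : ∀ k, 0 ≤ e k)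
    (he : Tendsto e atTop (𝓝 0)) : d =o[atTop] (fun k : ℕ => 1 / ((k : ℝ) + 1)) := by
  refine isLittleO_of_tendsto (fun k hk => absurd hk (by positivity)) ?_
  have hhalf : Tendsto (fun m : ℕ => m / 2 + 1) atTop atTop :=
    tendsto_atTop_mono (fun m => Nat.le_succ _) (Nat.tendsto_div_const_atTop two_ne_zero)
  have h4 : Tendsto (fun m : ℕ => 4 * e (m / 2 + 1)) atTop (𝓝 0) := by
    simpa using (he.comp hhalf).const_mul 4
  refine squeeze_zero' (Eventually.of_forall fun k => by have := hd0 k; positivity) ?_ h4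
  filter_upwards [eventually_ge_atTop 1] with m hm
  -- Sum only over indices from `m / 2 + 1` to `m`: at least `(m + 1) / 4` terms, each at least `d
  -- m`, with total at most `e (m / 2 + 1)`, which tends to zero.
  have h1 := mul_le_of_antitone hd h (j := m / 2 + 1) (by omega) (m - (m / 2 + 1))
  rw [show m / 2 + 1 + (m - (m / 2 + 1)) = m by omega] at h1
  have h2 : (m : ℝ) + 1 ≤ 4 * (((m - (m / 2 + 1) : ℕ) : ℝ) + 1) := by
    have : m + 1 ≤ 4 * ((m - (m / 2 + 1)) + 1) := by omega
    exact_mod_cast this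
  rw [div_div_eq_mul_div, div_one]
  have h3 := mul_le_mul_of_nonneg_right h2 (hd0 m)
  linarith [he0 (m + 1)]

theorem abs_le_l2norm {m : ℕ} (z : Fin m → ℝ) (i : Fin m) : |z i| ≤ l2norm z :=
  PiLp.norm_apply_le (WithLp.toLp 2 z) i

namespace SplitSpace

variable {n Nx Ng : ℕ} {p : Fin Ng → ℕ}

/-- The norm of the product type is a supremum norm; this bound transfers Euclidean estimates to its
topology. -/
theorem norm_le_sqrt_pairing (a : SplitSpace n Nx p) : ‖a‖ ≤ √(pairing a a) := by
  have h1 : ∀ t, l2norm (a.1 t) ≤ √(pairing a a) := fun t => by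
    refine Real.le_sqrt_of_sq_le ?_
    rw [pairing_self]
    have := Finset.single_le_sum (f := fun t => l2norm (a.1 t) ^ 2) (fun _ _ => by positivity)
      (Finset.mem_univ t)
    have h2 : 0 ≤ ∑ t, ∑ g, l2norm (a.2 t g) ^ 2 := by positivity
    linarith
  have h2 : ∀ t g, l2norm (a.2 t g) ≤ √(pairing a a) := fun t g => by
    refine Real.le_sqrt_of_sq_le ?_
    rw [pairing_self]
    have h3 := Finset.single_le_sum (f := fun g => l2norm (a.2 t g) ^ 2)
      (fun _ _ => by positivity) (Finset.mem_univ g)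
    have h4 := Finset.single_le_sum (f := fun t => ∑ g, l2norm (a.2 t g) ^ 2)
      (fun _ _ => by positivity) (Finset.mem_univ t)
    have h5 : 0 ≤ ∑ t, l2norm (a.1 t) ^ 2 := by positivity
    linarith
  have h0 := Real.sqrt_nonneg (pairing a a)
  refine max_le ((pi_norm_le_iff_of_nonneg h0).2 fun t => (pi_norm_le_iff_of_nonneg h0).2 fun i =>
    (abs_le_l2norm _ i).trans (h1 t)) ((pi_norm_le_iff_of_nonneg h0).2 fun t =>
    (pi_norm_le_iff_of_nonneg h0).2 fun g => (pi_norm_le_iff_of_nonneg h0).2 fun i =>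
    (abs_le_l2norm _ i).trans (h2 t g))

end SplitSpace

/-! ### The energy identity and its consequences -/

namespace GroupLasso

variable {n Nx Ny Ng : ℕ} {p : Fin Ng → ℕ} (D : GroupLasso n Nx Ny Ng p)

theorem omegaDistSq_eq (γ : ℝ) (ξ ξ' : Iterate n Nx Ng p) : D.omegaDistSq γ ξ ξ'
    = γ * pairing (D.split (ξ.v - ξ'.v)) (D.split (ξ.v - ξ'.v))
      + γ⁻¹ * pairing (ξ.dual - ξ'.dual) (ξ.dual - ξ'.dual) := by
  simp only [omegaDistSq, pairing_self, Finset.sum_add_distrib]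
  rfl

theorem omegaDistSq_nonneg {γ : ℝ} (hγ : 0 < γ) (ξ ξ' : Iterate n Nx Ng p) :
    0 ≤ D.omegaDistSq γ ξ ξ' := by
  rw [omegaDistSq_eq]
  have h1 := pairing_self_nonneg (D.split (p := p) (ξ.v - ξ'.v))
  have h2 := pairing_self_nonneg (ξ.dual - ξ'.dual)
  positivity

theorem norm_dual_sub_le {γ : ℝ} (hγ : 0 < γ) (ξ ξ' : Iterate n Nx Ng p) :
    ‖ξ.dual - ξ'.dual‖ ≤ √(γ * D.omegaDistSq γ ξ ξ') := by
  refine (norm_le_sqrt_pairing _).trans (Real.sqrt_le_sqrt ?_)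
  rw [omegaDistSq_eq, mul_add, mul_inv_cancel_left₀ hγ.ne']
  have h1 := pairing_self_nonneg (D.split (p := p) (ξ.v - ξ'.v))
  have : 0 ≤ γ * (γ * pairing (D.split (ξ.v - ξ'.v)) (D.split (ξ.v - ξ'.v))) := by positivity
  linarith

theorem norm_v_sub_le {γ : ℝ} (hγ : 0 < γ) (ξ ξ' : Iterate n Nx Ng p) :
    ‖ξ.v - ξ'.v‖ ≤ √(γ⁻¹ * D.omegaDistSq γ ξ ξ') := by
  have h0 : ‖ξ.v - ξ'.v‖ ≤ ‖D.split (ξ.v - ξ'.v)‖ := norm_fst_le (D.split (ξ.v - ξ'.v))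
  refine (h0.trans (norm_le_sqrt_pairing _)).trans (Real.sqrt_le_sqrt ?_)
  rw [omegaDistSq_eq, mul_add, inv_mul_cancel_left₀ hγ.ne']
  have h1 := pairing_self_nonneg (ξ.dual - ξ'.dual)
  have : 0 ≤ γ⁻¹ * (γ⁻¹ * pairing (ξ.dual - ξ'.dual) (ξ.dual - ξ'.dual)) := by positivity
  linarith

variable {D}

/-- The fundamental identity of ADMM for two steps. -/
theorem IsADMMStep.energy_identity {γ : ℝ} (hγ : 0 < γ) {ξ₁ ξ₁' ξ₂ ξ₂' : Iterate n Nx Ng p}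
    (h₁ : D.IsADMMStep γ ξ₁ ξ₁') (h₂ : D.IsADMMStep γ ξ₂ ξ₂') :
    D.omegaDistSq γ ξ₁ ξ₂ - D.omegaDistSq γ ξ₁' ξ₂'
      = -2 * pairing (D.uLin (ξ₁'.x - ξ₂'.x), ξ₁'.w - ξ₂'.w)
          ((ξ₁'.dual + γ • D.split (ξ₁'.v - ξ₁.v)) - (ξ₂'.dual + γ • D.split (ξ₂'.v - ξ₂.v)))
        + (γ * pairing (D.split ((ξ₁'.v - ξ₂'.v) - (ξ₁.v - ξ₂.v)))
              (D.split ((ξ₁'.v - ξ₂'.v) - (ξ₁.v - ξ₂.v)))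
            + γ⁻¹ * pairing ((ξ₁'.dual - ξ₂'.dual) - (ξ₁.dual - ξ₂.dual))
              ((ξ₁'.dual - ξ₂'.dual) - (ξ₁.dual - ξ₂.dual))
            - 2 * pairing (D.split ((ξ₁'.v - ξ₂'.v) - (ξ₁.v - ξ₂.v))) (ξ₁.dual - ξ₂.dual)) := by
  have hL : (D.uLin (ξ₁'.x - ξ₂'.x), ξ₁'.w - ξ₂'.w) = D.split (ξ₁'.v - ξ₂'.v)
      + γ⁻¹ • ((ξ₁'.dual - ξ₂'.dual) - (ξ₁.dual - ξ₂.dual)) := by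
    have e : (ξ₁'.dual - ξ₂'.dual) - (ξ₁.dual - ξ₂.dual)
        = γ • ((D.uLin (ξ₁'.x - ξ₂'.x), ξ₁'.w - ξ₂'.w) - D.split (ξ₁'.v - ξ₂'.v)) := by
      have e' : (D.uLin (ξ₁'.x - ξ₂'.x), ξ₁'.w - ξ₂'.w)
          = (D.u ξ₁'.x, ξ₁'.w) - (D.u ξ₂'.x, ξ₂'.w) := by rw [← u_sub]; rfl
      rw [h₁.dual, h₂.dual, e', map_sub]
      simp only [smul_sub]
      abel
    rw [e, smul_smul, inv_mul_cancel₀ hγ.ne', one_smul]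
    abel
  have hd : (ξ₁'.dual + γ • D.split (ξ₁'.v - ξ₁.v)) - (ξ₂'.dual + γ • D.split (ξ₂'.v - ξ₂.v))
      = (ξ₁'.dual - ξ₂'.dual) + γ • (D.split (ξ₁'.v - ξ₂'.v) - D.split (ξ₁.v - ξ₂.v)) := by
    simp only [map_sub, smul_sub]; abel
  have a1 : pairing (D.split (ξ₁'.v - ξ₂'.v)) (ξ₁'.dual - ξ₂'.dual) = 0 := by
    rw [map_sub, h₁.adj, h₂.adj, sub_zero]
  have a2 : pairing (D.split (ξ₁.v - ξ₂.v)) (ξ₁'.dual - ξ₂'.dual) = 0 := by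
    rw [map_sub, h₁.adj, h₂.adj, sub_zero]
  rw [hL, hd, omegaDistSq_eq, omegaDistSq_eq, map_sub D.split (ξ₁'.v - ξ₂'.v)]
  generalize D.split (ξ₁'.v - ξ₂'.v) = q' at *
  generalize D.split (ξ₁.v - ξ₂.v) = q at *
  generalize ξ₁'.dual - ξ₂'.dual = a' at *
  generalize ξ₁.dual - ξ₂.dual = a at *
  simp only [map_add, map_sub, map_smul, LinearMap.add_apply, LinearMap.sub_apply,
    LinearMap.smul_apply, smul_eq_mul, a1, a2, pairing_comm a' q', pairing_comm a' q,
    pairing_comm a q', pairing_comm a q, pairing_comm a a', pairing_comm q q']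
  field_simp
  ring

/-- New multipliers are orthogonal to the range of `D.split`, so the expression is the perfect
square `γ ‖q + γ⁻¹ (a' - a)‖²`. Nothing is needed of the old multipliers, so an arbitrary starting
point is allowed. -/
theorem energy_residual_nonneg {γ : ℝ} (hγ : 0 < γ) {ξ₁ ξ₁' ξ₂ ξ₂' : Iterate n Nx Ng p}
    (h₁ : D.IsADMMStep γ ξ₁ ξ₁') (h₂ : D.IsADMMStep γ ξ₂ ξ₂') :
    0 ≤ γ * pairing (D.split ((ξ₁'.v - ξ₂'.v) - (ξ₁.v - ξ₂.v)))
              (D.split ((ξ₁'.v - ξ₂'.v) - (ξ₁.v - ξ₂.v)))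
            + γ⁻¹ * pairing ((ξ₁'.dual - ξ₂'.dual) - (ξ₁.dual - ξ₂.dual))
              ((ξ₁'.dual - ξ₂'.dual) - (ξ₁.dual - ξ₂.dual))
            - 2 * pairing (D.split ((ξ₁'.v - ξ₂'.v) - (ξ₁.v - ξ₂.v))) (ξ₁.dual - ξ₂.dual) := by
  have a1 : pairing (D.split ((ξ₁'.v - ξ₂'.v) - (ξ₁.v - ξ₂.v))) (ξ₁'.dual - ξ₂'.dual) = 0 := by
    rw [map_sub, h₁.adj, h₂.adj, sub_zero]
  generalize D.split ((ξ₁'.v - ξ₂'.v) - (ξ₁.v - ξ₂.v)) = q at *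
  generalize ξ₁'.dual - ξ₂'.dual = a' at *
  generalize ξ₁.dual - ξ₂.dual = a at *
  have h := mul_nonneg hγ.le (pairing_self_nonneg (q + γ⁻¹ • (a' - a)))
  refine h.trans_eq ?_
  simp only [map_add, map_sub, map_smul, LinearMap.add_apply, LinearMap.sub_apply,
    LinearMap.smul_apply, smul_eq_mul, a1, pairing_comm a' q, pairing_comm a q, pairing_comm a a']
  field_simp
  ring

/-- The dual pairing of two critical points is monotone. -/
theorem IsCritical.pairing_nonpos (hD : D.PosDefCov) {ξ₁ ξ₂ : Iterate n Nx Ng p}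
    {y₁ y₂ : SplitSpace n Nx p} (h₁ : D.IsCritical ξ₁.x ξ₁.w y₁) (h₂ : D.IsCritical ξ₂.x ξ₂.w y₂) :
    pairing (D.uLin (ξ₁.x - ξ₂.x), ξ₁.w - ξ₂.w) (y₁ - y₂) ≤ 0 := by
  have e1 := h₁.obj_le hD ξ₂
  have e2 := h₂.obj_le hD ξ₁
  have e : (D.uLin (ξ₂.x - ξ₁.x), ξ₂.w - ξ₁.w) = -(D.uLin (ξ₁.x - ξ₂.x), ξ₁.w - ξ₂.w) := by
    rw [Prod.neg_mk, ← map_neg, neg_sub, neg_sub]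
  rw [e, map_neg, LinearMap.neg_apply] at e1
  rw [map_sub]
  linarith

theorem IsADMMStep.omegaDistSq_le (hD : D.PosDefCov) {γ : ℝ} (hγ : 0 < γ)
    {ξ₁ ξ₁' ξ₂ ξ₂' : Iterate n Nx Ng p}
    (h₁ : D.IsADMMStep γ ξ₁ ξ₁') (h₂ : D.IsADMMStep γ ξ₂ ξ₂') :
    D.omegaDistSq γ ξ₁' ξ₂' ≤ D.omegaDistSq γ ξ₁ ξ₂ := by
  have e1 := h₁.energy_identity hγ h₂
  have e2 := energy_residual_nonneg hγ h₁ h₂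
  have e3 := h₁.crit.pairing_nonpos hD h₂.crit
  linarith

/-- The `v`- and `η`-components of `F` vanish at a KKT point, by `stat_v` and feasibility. -/
theorem IsKKT.viGap_eq {ξs : Iterate n Nx Ng p} (h : D.IsKKT ξs) (ξ : Iterate n Nx Ng p) :
    D.viGap ξ ξs = D.splitObj ξ - D.splitObj ξs
      + pairing (D.uLin (ξ.x - ξs.x), ξ.w - ξs.w) ξs.dual := by
  have h1 : ∀ t, ξs.etaU t + ∑ g, (D.G g t)ᵀ *ᵥ ξs.etaW t g = 0 := D.adjoint_eq_zero h.adj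
  simp only [viGap, h1, h.u_eq, h.w_eq, sub_self, dotProduct_zero, Finset.sum_const_zero, add_zero,
    sub_zero, pairing_apply, ← u_sub, Iterate.dual, Pi.sub_apply]
  ring

theorem IsKKT.viGap_nonneg (hD : D.PosDefCov) {ξs : Iterate n Nx Ng p} (h : D.IsKKT ξs)
    (ξ : Iterate n Nx Ng p) : 0 ≤ D.viGap ξ ξs := by
  rw [h.viGap_eq]
  linarith [h.crit.obj_le hD ξ]

/-- Criticality of `ξ`, tested at `ξs`, bounds the gap by exactly the pairing that occurs in the
energy identity. -/
theorem IsKKT.viGap_le_pairing (hD : D.PosDefCov) {ξs ξ : Iterate n Nx Ng p} (h : D.IsKKT ξs)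
    {y : SplitSpace n Nx p} (hξ : D.IsCritical ξ.x ξ.w y) :
    D.viGap ξ ξs ≤ -pairing (D.uLin (ξ.x - ξs.x), ξ.w - ξs.w) (y - ξs.dual) := by
  have e1 := hξ.obj_le hD ξs
  have e : (D.uLin (ξs.x - ξ.x), ξs.w - ξ.w) = -(D.uLin (ξ.x - ξs.x), ξ.w - ξs.w) := by
    rw [Prod.neg_mk, ← map_neg, neg_sub, neg_sub]
  rw [e, map_neg, LinearMap.neg_apply] at e1
  rw [h.viGap_eq, map_sub (pairing _)]
  linarith

theorem IsADMMStep.viGap_le (hD : D.PosDefCov) {γ : ℝ} (hγ : 0 < γ) {ξs ξ ξ' : Iterate n Nx Ng p}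
    (hs : D.IsKKT ξs) (h : D.IsADMMStep γ ξ ξ') :
    2 * D.viGap ξ' ξs ≤ D.omegaDistSq γ ξ ξs - D.omegaDistSq γ ξ' ξs := by
  have e1 := h.energy_identity hγ (hs.isADMMStep γ)
  have e2 := energy_residual_nonneg hγ h (hs.isADMMStep γ)
  have e3 := hs.viGap_le_pairing hD h.crit
  rw [sub_self ξs.v, map_zero, smul_zero, add_zero] at e1
  linarith

/-- If the old multiplier also annihilates the range of `D.split`, the cross term of the energy
identity drops and its residual is the squared length of the step. -/
theorem IsADMMStep.omegaDistSq_step_le (hD : D.PosDefCov) {γ : ℝ} (hγ : 0 < γ)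
    {ξs ξ ξ' : Iterate n Nx Ng p} (hs : D.IsKKT ξs) (h : D.IsADMMStep γ ξ ξ')
    (hadj : ∀ v, pairing (D.split v) ξ.dual = 0) :
    D.omegaDistSq γ ξ ξ' ≤ D.omegaDistSq γ ξ ξs - D.omegaDistSq γ ξ' ξs := by
  have e1 := h.energy_identity hγ (hs.isADMMStep γ)
  have e2 := h.crit.pairing_nonpos hD (hs.isADMMStep γ).crit
  rw [map_sub (pairing (D.split _)) ξ.dual, hadj, hs.adj, sub_sub_sub_cancel_right,
    sub_sub_sub_cancel_right] at e1
  rw [D.omegaDistSq_eq γ ξ ξ', ← neg_sub ξ'.v, ← neg_sub ξ'.dual]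
  simp only [map_neg, LinearMap.neg_apply, neg_neg]
  linarith

/-! ### Convergence of the iterates -/

theorem eq_zero_of_uLin {h : Fin (n + 1) → Fin Nx → ℝ} (h0 : D.uLin h = 0) : h = 0 := by
  ext t : 1
  induction t using Fin.induction with
  | zero => exact congrFun h0 0
  | succ s ih =>
    have h1 : h s.succ - D.B s *ᵥ h s.castSucc = 0 := congrFun h0 s.succ
    rw [ih] at h1
    simpa using h1

variable (D) in
/-- `x` depends continuously on `u`. -/
theorem tendsto_of_tendsto_u {l : Filter ℕ} {x : ℕ → Fin (n + 1) → Fin Nx → ℝ}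
    {v : Fin (n + 1) → Fin Nx → ℝ} (h : Tendsto (fun k => D.u (x k)) l (𝓝 v)) :
    ∃ x₀, D.u x₀ = v ∧ Tendsto x l (𝓝 x₀) := by
  -- `uLin` is block lower bidiagonal with identity blocks on the diagonal, hence invertible for
  -- every choice of `B`.
  let e := LinearEquiv.ofInjectiveEndo D.uLin
    (LinearMap.ker_eq_bot.1 (LinearMap.ker_eq_bot'.2 fun _ => eq_zero_of_uLin))
  have he : ∀ z, D.uLin (e.symm z) = z := e.apply_symm_apply
  have hc : Continuous e.symm := e.symm.toLinearMap.continuous_of_finiteDimensional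
  refine ⟨e.symm (v - D.u 0), by rw [u_eq, he]; abel, ?_⟩
  have h1 := (hc.tendsto _).comp (h.sub_const (D.u 0))
  refine h1.congr fun k => ?_
  have h2 : D.u (x k) - D.u 0 = e (x k) := by
    have := u_sub (D := D) (x k) 0
    rw [sub_zero] at this
    exact this
  rw [Function.comp_apply, h2, e.symm_apply_apply]

theorem continuous_splitMap : Continuous (D.split (p := p)) :=
  D.split.continuous_of_finiteDimensional

/-- Limits of the iterates along which the steps vanish are KKT points. -/
theorem exists_isKKT_of_tendsto {γ : ℝ} (hγ : 0 < γ) {ξ : ℕ → Iterate n Nx Ng p}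
    (hξ : ∀ k, D.IsADMMStep γ (ξ k) (ξ (k + 1))) {l : Filter ℕ} [l.NeBot]
    {v : Fin (n + 1) → Fin Nx → ℝ} {y : SplitSpace n Nx p}
    (hv : Tendsto (fun k => (ξ (k + 1)).v) l (𝓝 v))
    (hy : Tendsto (fun k => (ξ (k + 1)).dual) l (𝓝 y))
    (hv0 : Tendsto (fun k => (ξ (k + 1)).v - (ξ k).v) l (𝓝 0))
    (hy0 : Tendsto (fun k => (ξ (k + 1)).dual - (ξ k).dual) l (𝓝 0)) :
    ∃ ξs, D.IsKKT ξs ∧ ξs.v = v ∧ ξs.dual = y ∧ Tendsto (fun k => (ξ (k + 1)).x) l (𝓝 ξs.x) ∧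
      Tendsto (fun k => (ξ (k + 1)).w) l (𝓝 ξs.w) := by
  have hsplit : Tendsto (fun k => D.split (ξ (k + 1)).v) l (𝓝 (D.split v)) :=
    (continuous_splitMap.tendsto v).comp hv
  have hfeas : Tendsto (fun k => (D.u (ξ (k + 1)).x, (ξ (k + 1)).w)) l (𝓝 (D.split v)) := by
    -- The constraint residual is `γ⁻¹` times the multiplier increment, so vanishing increments give
    -- feasibility in the limit.
    have h1 := hsplit.add (hy0.const_smul γ⁻¹)
    rw [smul_zero, add_zero] at h1
    refine h1.congr fun k => ?_
    rw [(hξ k).dual, add_sub_cancel_left, smul_smul, inv_mul_cancel₀ hγ.ne', one_smul]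
    abel
  have hu : Tendsto (fun k => D.u (ξ (k + 1)).x) l (𝓝 v) := (continuous_fst.tendsto _).comp hfeas
  have hw : Tendsto (fun k => (ξ (k + 1)).w) l (𝓝 (D.split v).2) :=
    (continuous_snd.tendsto _).comp hfeas
  obtain ⟨x, hx, hxt⟩ := D.tendsto_of_tendsto_u hu
  have hdual : Tendsto (fun k => (ξ (k + 1)).dual + γ • D.split ((ξ (k + 1)).v - (ξ k).v)) l
      (𝓝 y) := by
    have h1 := hy.add (((continuous_splitMap (D := D)).tendsto 0).comp hv0 |>.const_smul γ)
    rw [map_zero, smul_zero, add_zero] at h1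
    exact h1
  refine ⟨⟨x, (D.split v).2, v, y.1, y.2⟩, ⟨⟨fun h => ?_, fun t g z => ?_⟩, fun z => ?_, ?_⟩, rfl,
    rfl, hxt, hw⟩
  · have h1 : Continuous fun x => D.hess x h :=
      (D.hess.flip h).continuous_of_finiteDimensional
    have h2 : Continuous fun y => pairing (D.uLin h, (0 : _)) (y : SplitSpace n Nx p) :=
      (pairing _).continuous_of_finiteDimensional
    have h3 := (((h1.tendsto x).comp hxt).const_add (D.grad₀ h)).add ((h2.tendsto y).comp hdual)
    refine tendsto_nhds_unique h3 (tendsto_const_nhds.congr fun k => ?_)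
    exact ((hξ k).crit.grad h).symm
  · have h1 : Tendsto (fun k => (ξ (k + 1)).w t g) l (𝓝 ((D.split v).2 t g)) :=
      tendsto_pi_nhds.1 (tendsto_pi_nhds.1 hw t) g
    have h2 : Tendsto (fun k => ((ξ (k + 1)).dual + γ • D.split ((ξ (k + 1)).v - (ξ k).v)).2 t g) l
        (𝓝 (y.2 t g)) :=
      tendsto_pi_nhds.1 (tendsto_pi_nhds.1 ((continuous_snd.tendsto _).comp hdual) t) g
    have h3 : Continuous fun q : (Fin (p g) → ℝ) × (Fin (p g) → ℝ) =>
        D.μ * l2norm q.1 + (-q.2) ⬝ᵥ (z - q.1) :=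
      (continuous_const.mul (continuous_l2norm.comp continuous_fst)).add
        (continuous_snd.neg.dotProduct (continuous_const.sub continuous_fst))
    exact le_of_tendsto ((h3.tendsto (_, _)).comp (h1.prodMk_nhds h2))
      (Eventually.of_forall fun k => (hξ k).crit.sub t g z)
  · have h2 : Continuous fun y : SplitSpace n Nx p => pairing (D.split z) y :=
      (pairing _).continuous_of_finiteDimensional
    exact tendsto_nhds_unique ((h2.tendsto y).comp hy)
      (tendsto_const_nhds.congr fun k => ((hξ k).adj z).symm)
  · simp only [hx]
    rfl

theorem tendsto_of_omegaDistSq {γ : ℝ} (hγ : 0 < γ) {ξ ζ : ℕ → Iterate n Nx Ng p}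
    {l : Filter ℕ} (h : Tendsto (fun k => D.omegaDistSq γ (ξ k) (ζ k)) l (𝓝 0)) :
    Tendsto (fun k => (ξ k).v - (ζ k).v) l (𝓝 0) ∧
      Tendsto (fun k => (ξ k).dual - (ζ k).dual) l (𝓝 0) := by
  constructor
  · refine squeeze_zero_norm (fun k => D.norm_v_sub_le hγ (ξ k) (ζ k)) ?_
    simpa using (h.const_mul γ⁻¹).sqrt
  · refine squeeze_zero_norm (fun k => D.norm_dual_sub_le hγ (ξ k) (ζ k)) ?_
    simpa using (h.const_mul γ).sqrt

theorem omegaDistSq_comm (γ : ℝ) (ξ ξ' : Iterate n Nx Ng p) :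
    D.omegaDistSq γ ξ ξ' = D.omegaDistSq γ ξ' ξ := by
  rw [omegaDistSq_eq, omegaDistSq_eq, ← neg_sub ξ'.v, ← neg_sub ξ'.dual]
  simp only [map_neg, LinearMap.neg_apply, neg_neg]

section Sequence

variable (hD : D.PosDefCov) {γ : ℝ} (hγ : 0 < γ) {ξ : ℕ → Iterate n Nx Ng p}
  (hξ : ∀ k, D.IsADMMStep γ (ξ k) (ξ (k + 1)))
include hD hγ hξ

theorem antitone_omegaDistSq {ξs : Iterate n Nx Ng p} (hs : D.IsKKT ξs) :
    Antitone fun k => D.omegaDistSq γ (ξ k) ξs :=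
  antitone_nat_of_succ_le fun k => (hξ k).omegaDistSq_le hD hγ (hs.isADMMStep γ)

theorem antitone_omegaDistSq_step : Antitone fun k => D.omegaDistSq γ (ξ k) (ξ (k + 1)) :=
  antitone_nat_of_succ_le fun k => (hξ k).omegaDistSq_le hD hγ (hξ (k + 1))

/-- The index `0` is excluded because the multipliers of an arbitrary starting point need not
satisfy the adjoint condition. -/
theorem omegaDistSq_succ_le {ξs : Iterate n Nx Ng p} (hs : D.IsKKT ξs) {k : ℕ} (hk : 1 ≤ k) :
    D.omegaDistSq γ (ξ k) (ξ (k + 1))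
      ≤ D.omegaDistSq γ (ξ k) ξs - D.omegaDistSq γ (ξ (k + 1)) ξs := by
  obtain ⟨k, rfl⟩ := Nat.exists_eq_add_of_le' hk
  exact (hξ (k + 1)).omegaDistSq_step_le hD hγ hs (hξ k).adj

/-- The distance to a KKT point is antitone and bounded below, hence convergent; its decrements tend
to zero and dominate the steps. -/
theorem tendsto_omegaDistSq_step (hμ : 0 < D.μ) :
    Tendsto (fun k => D.omegaDistSq γ (ξ k) (ξ (k + 1))) atTop (𝓝 0) := by
  obtain ⟨ξs, hs⟩ := exists_isKKT hD hμ
  have h1 := tendsto_atTop_ciInf (antitone_omegaDistSq hD hγ hξ hs)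
    ⟨0, by rintro _ ⟨k, rfl⟩; exact D.omegaDistSq_nonneg hγ _ _⟩
  have h2 := h1.sub (h1.comp (tendsto_add_atTop_nat 1))
  rw [sub_self] at h2
  refine squeeze_zero' (Eventually.of_forall fun k => D.omegaDistSq_nonneg hγ _ _) ?_ h2
  filter_upwards [eventually_ge_atTop 1] with k hk using omegaDistSq_succ_le hD hγ hξ hs hk

/-- The iterates have a cluster point that is a KKT point. -/
theorem exists_isKKT_subseq (hμ : 0 < D.μ) : ∃ ξs, D.IsKKT ξs ∧ ∃ φ : ℕ → ℕ, StrictMono φ ∧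
    Tendsto (fun k => (ξ (φ k + 1)).v) atTop (𝓝 ξs.v) ∧
    Tendsto (fun k => (ξ (φ k + 1)).dual) atTop (𝓝 ξs.dual) := by
  obtain ⟨ξ₀, h₀⟩ := exists_isKKT hD hμ
  have hanti := antitone_omegaDistSq hD hγ hξ h₀
  obtain ⟨⟨v, y⟩, φ, hφ, hlim⟩ : ∃ a : (Fin (n + 1) → Fin Nx → ℝ) × SplitSpace n Nx p,
      ∃ φ : ℕ → ℕ, StrictMono φ ∧
        Tendsto ((fun k => ((ξ (k + 1)).v, (ξ (k + 1)).dual)) ∘ φ) atTop (𝓝 a) := by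
    obtain ⟨a, -, φ, h⟩ := tendsto_subseq_of_bounded (Metric.isBounded_closedBall
      (x := (ξ₀.v, ξ₀.dual)) (r := max √(γ⁻¹ * D.omegaDistSq γ (ξ 0) ξ₀)
        √(γ * D.omegaDistSq γ (ξ 0) ξ₀)))
      (x := fun k => ((ξ (k + 1)).v, (ξ (k + 1)).dual)) fun k => by
        rw [mem_closedBall_iff_norm, Prod.mk_sub_mk]
        exact max_le_max
          ((D.norm_v_sub_le hγ _ _).trans (Real.sqrt_le_sqrt
            (mul_le_mul_of_nonneg_left (hanti (Nat.zero_le _)) (inv_pos.2 hγ).le)))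
          ((D.norm_dual_sub_le hγ _ _).trans (Real.sqrt_le_sqrt
            (mul_le_mul_of_nonneg_left (hanti (Nat.zero_le _)) hγ.le)))
    exact ⟨a, φ, h⟩
  have hstep := tendsto_omegaDistSq_step hD hγ hξ hμ
  simp only [D.omegaDistSq_comm γ (ξ _) (ξ (_ + 1))] at hstep
  obtain ⟨hv0, hy0⟩ := tendsto_of_omegaDistSq hγ hstep
  have hle : map φ atTop ≤ atTop := hφ.tendsto_atTop
  -- A subsequence is treated as a filter, so one limit lemma covers both the subsequence and the
  -- full sequence.
  obtain ⟨ξs, hs, rfl, rfl, -⟩ := exists_isKKT_of_tendsto (l := map φ atTop) (v := v) (y := y) hγ hξ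
    (tendsto_map'_iff.2 ((continuous_fst.tendsto _).comp hlim))
    (tendsto_map'_iff.2 ((continuous_snd.tendsto _).comp hlim)) (hv0.mono_left hle)
    (hy0.mono_left hle)
  exact ⟨ξs, hs, φ, hφ, (continuous_fst.tendsto _).comp hlim, (continuous_snd.tendsto _).comp hlim⟩

omit hD hγ hξ in
theorem tendsto_omegaDistSq_of_tendsto {l : Filter ℕ} {ξs : Iterate n Nx Ng p} {φ : ℕ → ℕ}
    (hv : Tendsto (fun k => (ξ (φ k)).v) l (𝓝 ξs.v))
    (hy : Tendsto (fun k => (ξ (φ k)).dual) l (𝓝 ξs.dual)) :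
    Tendsto (fun k => D.omegaDistSq γ (ξ (φ k)) ξs) l (𝓝 0) := by
  have hc : Continuous fun y : SplitSpace n Nx p => pairing y y := by
    have h2 : Continuous fun y : SplitSpace n Nx p => pairing.toContinuousBilinearMap y y := by
      fun_prop
    exact h2
  have h1 := (hc.comp (continuous_splitMap (D := D))).tendsto (ξs.v - ξs.v) |>.comp
    (hv.sub_const ξs.v)
  have h2 := (hc.tendsto (ξs.dual - ξs.dual)).comp (hy.sub_const ξs.dual)
  have h3 := (h1.const_mul γ).add (h2.const_mul γ⁻¹)
  simp only [Function.comp_apply, sub_self, map_zero, mul_zero, add_zero] at h3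
  exact h3.congr fun k => (D.omegaDistSq_eq γ _ _).symm

/-- Convergence of the iterates to a KKT point. -/
theorem exists_isKKT_tendsto (hμ : 0 < D.μ) : ∃ ξs, D.IsKKT ξs ∧
    Tendsto (fun k => (ξ k).x) atTop (𝓝 ξs.x) ∧ Tendsto (fun k => (ξ k).w) atTop (𝓝 ξs.w) ∧
    Tendsto (fun k => (ξ k).v) atTop (𝓝 ξs.v) ∧
    Tendsto (fun k => (ξ k).dual) atTop (𝓝 ξs.dual) := by
  obtain ⟨ξ₁, h₁, φ, hφ, hv, hy⟩ := exists_isKKT_subseq hD hγ hξ hμ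
  have hsub := tendsto_omegaDistSq_of_tendsto (D := D) (γ := γ) hv hy
  have hφ1 : Tendsto (fun k => φ k + 1) atTop atTop :=
    (tendsto_add_atTop_nat 1).comp hφ.tendsto_atTop
  -- An antitone distance that tends to zero along a subsequence tends to zero along the whole
  -- sequence.
  have hfull : Tendsto (fun k => D.omegaDistSq γ (ξ k) ξ₁) atTop (𝓝 0) :=
    (tendsto_iff_tendsto_subseq_of_antitone (antitone_omegaDistSq hD hγ hξ h₁) hφ1).2 hsub
  obtain ⟨hv1, hy1⟩ := tendsto_of_omegaDistSq (ζ := fun _ => ξ₁) hγ hfull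
  have hv2 : Tendsto (fun k => (ξ k).v) atTop (𝓝 ξ₁.v) := tendsto_sub_nhds_zero_iff.1 hv1
  have hy2 : Tendsto (fun k => (ξ k).dual) atTop (𝓝 ξ₁.dual) := tendsto_sub_nhds_zero_iff.1 hy1
  have hstep := tendsto_omegaDistSq_step hD hγ hξ hμ
  simp only [D.omegaDistSq_comm γ (ξ _) (ξ (_ + 1))] at hstep
  obtain ⟨hv0, hy0⟩ := tendsto_of_omegaDistSq hγ hstep
  -- The Ω-distance does not see `x` and `w`; their limits come from a second passage to the limit,
  -- now along the full sequence.
  obtain ⟨ξs, hs, hsv, hsy, hx, hw⟩ := exists_isKKT_of_tendsto hγ hξ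
    (hv2.comp (tendsto_add_atTop_nat 1)) (hy2.comp (tendsto_add_atTop_nat 1)) hv0 hy0
  exact ⟨ξs, hs, (tendsto_add_atTop_iff_nat (f := fun k => (ξ k).x) 1).1 hx,
    (tendsto_add_atTop_iff_nat (f := fun k => (ξ k).w) 1).1 hw, hsv ▸ hv2, hsy ▸ hy2⟩

end Sequence

/-! ### Ergodic rates -/

theorem convexOn_fit (hD : D.PosDefCov) : ConvexOn ℝ Set.univ D.fit := by
  refine ⟨convex_univ, fun x _ y _ a b ha hb hab => ?_⟩
  -- Average the two tangent inequalities at the convex combination; their linear terms cancel.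
  have h1 := mul_le_mul_of_nonneg_left (fit_ge hD (a • x + b • y) x) ha
  have h2 := mul_le_mul_of_nonneg_left (fit_ge hD (a • x + b • y) y) hb
  obtain rfl : b = 1 - a := by linarith
  simp only [map_sub, map_add, map_smul, smul_eq_mul, LinearMap.add_apply,
    LinearMap.smul_apply] at h1 h2 ⊢
  linarith

/-- Jensen's inequality for the gap. -/
theorem IsKKT.viGap_mean_le (hD : D.PosDefCov) (hμ : 0 < D.μ) {ξs : Iterate n Nx Ng p}
    (hs : D.IsKKT ξs) (ξ : ℕ → Iterate n Nx Ng p) (j k : ℕ) :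
    D.viGap (Iterate.mean ξ j k) ξs
      ≤ ((k : ℝ) + 1)⁻¹ * ∑ i ∈ Finset.range (k + 1), D.viGap (ξ (j + i + 1)) ξs := by
  have hk : (0 : ℝ) < (k : ℝ) + 1 := by positivity
  have hc : 0 ≤ ((k : ℝ) + 1)⁻¹ := by positivity
  have hsum : ∑ _i ∈ Finset.range (k + 1), ((k : ℝ) + 1)⁻¹ = 1 := by
    rw [Finset.sum_const, Finset.card_range, nsmul_eq_mul]
    push_cast
    exact mul_inv_cancel₀ hk.ne'
  have h1 := (convexOn_fit hD).map_sum_le (t := Finset.range (k + 1))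
    (w := fun _ => ((k : ℝ) + 1)⁻¹) (p := fun i => (ξ (j + i + 1)).x) (fun _ _ => hc) hsum
    (fun _ _ => Set.mem_univ _)
  have h2 : ∀ t g, D.μ * l2norm ((Iterate.mean ξ j k).w t g)
      ≤ ∑ i ∈ Finset.range (k + 1), ((k : ℝ) + 1)⁻¹ * (D.μ * l2norm ((ξ (j + i + 1)).w t g)) :=
    fun t g => by
      have := convexOn_l2norm.map_sum_le (t := Finset.range (k + 1))
        (w := fun _ => ((k : ℝ) + 1)⁻¹) (p := fun i => (ξ (j + i + 1)).w t g) (fun _ _ => hc) hsum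
        (fun _ _ => Set.mem_univ _)
      have e : (Iterate.mean ξ j k).w t g
          = ∑ i ∈ Finset.range (k + 1), ((k : ℝ) + 1)⁻¹ • (ξ (j + i + 1)).w t g := by
        simp [Iterate.mean, Finset.smul_sum, Finset.sum_apply]
      rw [e]
      refine (mul_le_mul_of_nonneg_left this hμ.le).trans_eq ?_
      rw [Finset.mul_sum]
      exact Finset.sum_congr rfl fun i _ => by rw [smul_eq_mul]; ring
  have h3 : ∑ t, ∑ g, D.μ * l2norm ((Iterate.mean ξ j k).w t g)
      ≤ ∑ i ∈ Finset.range (k + 1),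
        ((k : ℝ) + 1)⁻¹ * ∑ t, ∑ g, D.μ * l2norm ((ξ (j + i + 1)).w t g) := by
    refine (Finset.sum_le_sum fun t _ => Finset.sum_le_sum fun g _ => h2 t g).trans_eq ?_
    simp only [Finset.mul_sum]
    rw [Finset.sum_comm (s := Finset.range (k + 1))]
    exact Finset.sum_congr rfl fun t _ => Finset.sum_comm
  -- This part is affine in the point and the weights sum to one, so averaging is exact; only `fit`
  -- and the norms need Jensen's inequality.
  have h4 : pairing (D.uLin ((Iterate.mean ξ j k).x - ξs.x), (Iterate.mean ξ j k).w - ξs.w) ξs.dual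
      = ∑ i ∈ Finset.range (k + 1), ((k : ℝ) + 1)⁻¹ *
        pairing (D.uLin ((ξ (j + i + 1)).x - ξs.x), (ξ (j + i + 1)).w - ξs.w) ξs.dual := by
    have e : (D.uLin ((Iterate.mean ξ j k).x - ξs.x), (Iterate.mean ξ j k).w - ξs.w)
        = ∑ i ∈ Finset.range (k + 1), ((k : ℝ) + 1)⁻¹ •
          ((D.uLin ((ξ (j + i + 1)).x - ξs.x), (ξ (j + i + 1)).w - ξs.w) : SplitSpace n Nx p) := by
      refine Prod.ext ?_ ?_
      · rw [Prod.fst_sum]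
        simp only [Prod.smul_fst, map_sub, smul_sub, Finset.sum_sub_distrib, ← Finset.sum_smul,
          hsum, one_smul, Iterate.mean, map_smul, map_sum, Finset.smul_sum]
      · rw [Prod.snd_sum]
        simp only [Prod.smul_snd, smul_sub, Finset.sum_sub_distrib, ← Finset.sum_smul,
          hsum, one_smul, Iterate.mean, Finset.smul_sum]
    rw [e, map_sum, LinearMap.sum_apply]
    simp only [map_smul, LinearMap.smul_apply, smul_eq_mul]
  have e1 : (Iterate.mean ξ j k).x
      = ∑ i ∈ Finset.range (k + 1), ((k : ℝ) + 1)⁻¹ • (ξ (j + i + 1)).x := by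
    simp [Iterate.mean, Finset.smul_sum]
  rw [← e1] at h1
  have h5 : D.splitObj ξs = ∑ i ∈ Finset.range (k + 1), ((k : ℝ) + 1)⁻¹ * D.splitObj ξs := by
    rw [← Finset.sum_mul, hsum, one_mul]
  simp only [smul_eq_mul] at h1
  simp only [hs.viGap_eq, Finset.mul_sum, mul_add, mul_sub, Finset.sum_add_distrib,
    Finset.sum_sub_distrib, ← h5]
  simp only [splitObj, mul_add, Finset.sum_add_distrib] at h1 h3 ⊢
  linarith

theorem IsKKT.viGap_mean_le_omegaDistSq (hD : D.PosDefCov) (hμ : 0 < D.μ) {γ : ℝ} (hγ : 0 < γ)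
    {ξ : ℕ → Iterate n Nx Ng p} (hξ : ∀ k, D.IsADMMStep γ (ξ k) (ξ (k + 1)))
    {ξs : Iterate n Nx Ng p} (hs : D.IsKKT ξs) (j k : ℕ) :
    D.viGap (Iterate.mean ξ j k) ξs ≤ D.omegaDistSq γ (ξ j) ξs / ((k : ℝ) + 1) := by
  refine (hs.viGap_mean_le hD hμ ξ j k).trans ?_
  rw [div_eq_inv_mul]
  refine mul_le_mul_of_nonneg_left ?_ (by positivity)
  have h1 : ∀ m, ∑ i ∈ Finset.range m, D.viGap (ξ (j + i + 1)) ξs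
      ≤ D.omegaDistSq γ (ξ j) ξs - D.omegaDistSq γ (ξ (j + m)) ξs := fun m => by
    induction m with
    | zero => simp
    | succ m ih =>
      rw [Finset.sum_range_succ, ← add_assoc]
      have h2 := (hξ (j + m)).viGap_le hD hγ hs
      have h3 := hs.viGap_nonneg hD (ξ (j + m + 1))
      -- `viGap_le` bounds twice the gap; the spare copy is discarded by nonnegativity.
      linarith
  linarith [h1 (k + 1), D.omegaDistSq_nonneg hγ (ξ (j + (k + 1))) ξs]

end GroupLasso

end
theorem theorem1 {n Nx Ny Ng : ℕ} {p : Fin Ng → ℕ} (D : GroupLasso n Nx Ny Ng p)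
    (hμ : 0 < D.μ)
    (hR : ∀ t, (D.R t).PosSemidef) (hR' : ∀ t, IsUnit (D.R t))
    (hQ : ∀ t, (D.Q t).PosSemidef) (hQ' : ∀ t, IsUnit (D.Q t))
    (hP : D.P₁.PosSemidef) (hP' : IsUnit D.P₁)
    (γ : ℝ) (hγ : 0 < γ)
    (ξ : ℕ → Iterate n Nx Ng p) (hξ : ∀ k, D.KSmADMMStep γ (ξ k) (ξ (k + 1))) :
    (∀ k, IsMinOn (D.xCost γ (ξ k)) Set.univ (ξ (k + 1)).x) ∧
    ∃ ξs : Iterate n Nx Ng p,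
      Tendsto (fun k => (ξ k).x) atTop (𝓝 ξs.x) ∧
      Tendsto (fun k => (ξ k).w) atTop (𝓝 ξs.w) ∧
      Tendsto (fun k => (ξ k).v) atTop (𝓝 ξs.v) ∧
      Tendsto (fun k => (ξ k).etaU) atTop (𝓝 ξs.etaU) ∧
      Tendsto (fun k => (ξ k).etaW) atTop (𝓝 ξs.etaW) ∧
      D.IsStationary ξs ∧
      IsMinOn D.objective Set.univ ξs.x ∧
      (∀ j k : ℕ, 0 ≤ D.viGap (Iterate.mean ξ j k) ξs ∧
        D.viGap (Iterate.mean ξ j k) ξs ≤ D.omegaDistSq γ (ξ j) ξs / ((k : ℝ) + 1)) ∧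
      (fun k : ℕ => D.viGap (Iterate.mean ξ k k) ξs) =o[atTop] (fun k : ℕ => 1 / ((k : ℝ) + 1)) ∧
      (fun k : ℕ => D.omegaDistSq γ (ξ k) (ξ (k + 1))) =o[atTop]
        (fun k : ℕ => 1 / ((k : ℝ) + 1)) := by
  have hD : D.PosDefCov := ⟨fun t => (hR t).posDef_iff_isUnit.2 (hR' t),
    fun t => (hQ t).posDef_iff_isUnit.2 (hQ' t), hP.posDef_iff_isUnit.2 hP'⟩
  have hstep : ∀ k, D.IsADMMStep γ (ξ k) (ξ (k + 1)) := fun k => (hξ k).isADMMStep hD hμ hγ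
  obtain ⟨ξs, hs, hx, hw, hv, hy⟩ := GroupLasso.exists_isKKT_tendsto hD hγ hstep hμ
  have hdist : Tendsto (fun k => D.omegaDistSq γ (ξ k) ξs) atTop (𝓝 0) :=
    GroupLasso.tendsto_omegaDistSq_of_tendsto (φ := id) hv hy
  have hgap := hs.viGap_mean_le_omegaDistSq hD hμ hγ hstep
  refine ⟨fun k => ?_, ξs, hx, hw, hv, (continuous_fst.tendsto _).comp hy,
    (continuous_snd.tendsto _).comp hy, hs.isStationary hD, hs.isMinOn_objective hD,
    fun j k => ⟨hs.viGap_nonneg hD _, hgap j k⟩, ?_, ?_⟩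
  · rw [show (ξ (k + 1)).x = _ from funext (hξ k).x_update]
    exact GroupLasso.isMinOn_xCost hD hγ (ξ k)
  -- The mean started at `j = k` is controlled by the distance of the `k`-th iterate to its own
  -- limit, which tends to zero.
  · refine isLittleO_of_tendsto (fun k hk => absurd hk (by positivity)) ?_
    refine squeeze_zero (fun k => div_nonneg (hs.viGap_nonneg hD _) (by positivity)) (fun k => ?_)
      hdist
    rw [div_div_eq_mul_div, div_one]
    exact (le_div_iff₀ (by positivity)).1 (hgap k k)
  · exact isLittleO_of_antitone (GroupLasso.antitone_omegaDistSq_step hD hγ hstep)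
      (fun k => D.omegaDistSq_nonneg hγ _ _)
      (fun k hk => GroupLasso.omegaDistSq_succ_le hD hγ hstep hs hk)
      (fun k => D.omegaDistSq_nonneg hγ _ _) hdist
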